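/- Let $(\varepsilon_t)_{t\in\mathbb Z}$ be i.i.d. real random variables on a probability space $(\Omega,\mathcal A,P)$ with continuous (atomless) distribution, $E\varepsilon_t=0$ and $E\varepsilon_t^2=1$; let $a\in\mathbb R$, $a\neq 0$, and let $(b_j)_{j\ge1}$ be real numbers with $\sum_{j\ge 1}b_j^2<1$. Consider the LARCH equations $$X_t=\varepsilon_t\sigma_t,\qquad \sigma_t=a+\sum_{j=1}^\infty b_jX_{t-j}\qquad\text{(almost surely, for every } t\in\mathbb Z),$$ and call a solution $(X_t,\sigma_t)_{t\in\mathbb Z}$, for which the series in the second equation is only required to converge in probability, nonanticipative if, for every $t$, $\varepsilon_t$ is independent of the past $(\varepsilon_s,X_s)_{s<t}$. Then there exists a nonanticipative solution $(X_t,\sigma_t)_{t\in\mathbb Z}$ on $(\Omega,\mathcal A,P)$ that is, as a bivariate process, strictly stationary and second-order stationary; for it, the series $\sum_j b_jX_{t-j}$ converges both in $L^2(P)$ and almost surely. It is unique: any other nonanticipative, strictly and second-order stationary solution $(X'_t,\sigma'_t)_{t\in\mathbb Z}$ on $(\Omega,\mathcal A,P)$ satisfies $X'_t=X_t$ and $\sigma'_t=\sigma_t$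 almost surely for every $t$. It is given by the Volterra series $$\sigma_t=a+a\sum_{k=1}^\infty\ \sum_{j_1,\dots,j_k=1}^\infty b_{j_1}\cdots b_{j_k}\,\varepsilon_{t-j_1}\varepsilon_{t-j_1-j_2}\cdots\varepsilon_{t-j_1-\cdots-j_k},\qquad X_t=\varepsilon_t\sigma_t ,$$ which converges unconditionally in $L^2(P)$. Moreover, this solution is ergodic: the time shift on $(\mathbb R^2)^{\mathbb Z}$ is ergodic with respect to the law of $(X_t,\sigma_t)_{t\in\mathbb Z}$. -/

import Mathlib

open MeasureTheory ProbabilityTheory Filter Topology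

/-- The innovations: real random variables `ε t`, `t ∈ ℤ`, that are independent and identically
distributed, with continuous (atomless) distribution, mean `0` and second moment `1`. -/
structure IsInnovation {Ω : Type*} [MeasurableSpace Ω] (μ : Measure Ω) (ε : ℤ → Ω → ℝ) :
    Prop where
  measurable : ∀ t, Measurable (ε t)
  indep : iIndepFun ε μ
  identDistrib : ∀ s t, IdentDistrib (ε s) (ε t) μ μ
  continuous_law : ∀ t x, μ {ω | ε t ω = x} = 0
  mean_zero : ∀ t, ∫ ω, ε t ω ∂μ = 0
  second_moment : ∀ t, ∫ ω, (ε t ω) ^ 2 ∂μ = 1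

/-- The partial sum `a + b₁ X_{t-1} + ⋯ + bₙ X_{t-n}` (the summation index is `j = i + 1`). -/
noncomputable def larchPartialSum {Ω : Type*} (a : ℝ) (b : ℕ+ → ℝ) (X : ℤ → Ω → ℝ) (t : ℤ)
    (n : ℕ) (ω : Ω) : ℝ :=
  a + ∑ i ∈ Finset.range n, b i.succPNat * X (t - (i + 1)) ω

/-- `(X, σ)` solves the LARCH equations `X_t = ε_t σ_t`, `σ_t = a + ∑_{j ≥ 1} b_j X_{t-j}`
(almost surely, for every `t`).  The series is only asked to converge in probability, the weakest
of the usual modes of convergence. -/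
structure IsLARCHSolution {Ω : Type*} [MeasurableSpace Ω] (μ : Measure Ω) (a : ℝ) (b : ℕ+ → ℝ)
    (ε X σ : ℤ → Ω → ℝ) : Prop where
  measurable_X : ∀ t, Measurable (X t)
  measurable_σ : ∀ t, Measurable (σ t)
  eq_X : ∀ t, ∀ᵐ ω ∂μ, X t ω = ε t ω * σ t ω
  eq_σ : ∀ t, TendstoInMeasure μ (larchPartialSum a b X t) atTop (σ t)

/-- Nonanticipativity (causality): the innovation at time `t` is independent of the past
`(ε_s, X_s)_{s < t}`. -/
def IsNonanticipative {Ω : Type*} [MeasurableSpace Ω] (μ : Measure Ω) (ε X : ℤ → Ω → ℝ) : Prop :=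
  ∀ t : ℤ, IndepFun (ε t) (fun ω (s : Set.Iio t) => (ε s ω, X s ω)) μ

/-- The trajectory `t ↦ (X_t, σ_t)` as a random element of `(ℝ × ℝ)^ℤ`. -/
def pairPath {Ω : Type*} (X σ : ℤ → Ω → ℝ) (ω : Ω) : ℤ → ℝ × ℝ :=
  fun t => (X t ω, σ t ω)

/-- The time shift on the space of two-sided sequences. -/
def timeShift {E : Type*} (h : ℤ) (x : ℤ → E) : ℤ → E :=
  fun t => x (t + h)

/-- Strict stationarity of the bivariate process `(X_t, σ_t)_{t ∈ ℤ}`: all its time shifts have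
the same law on `(ℝ × ℝ)^ℤ` (equivalently, the same finite-dimensional distributions). -/
def IsStrictlyStationary {Ω : Type*} [MeasurableSpace Ω] (μ : Measure Ω) (X σ : ℤ → Ω → ℝ) :
    Prop :=
  ∀ h : ℤ, μ.map (fun ω => timeShift h (pairPath X σ ω)) = μ.map (pairPath X σ)

/-- Second-order stationarity of the bivariate process `(X_t, σ_t)_{t ∈ ℤ}`: square integrability,
means constant in time, and all covariances (cross-covariances included) invariant under time
shifts. -/
structure IsSecondOrderStationary {Ω : Type*} [MeasurableSpace Ω] (μ : Measure Ω)
    (X σ : ℤ → Ω → ℝ) : Prop where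
  memLp_X : ∀ t, MemLp (X t) 2 μ
  memLp_σ : ∀ t, MemLp (σ t) 2 μ
  mean_X : ∀ s t, ∫ ω, X s ω ∂μ = ∫ ω, X t ω ∂μ
  mean_σ : ∀ s t, ∫ ω, σ s ω ∂μ = ∫ ω, σ t ω ∂μ
  cov_X : ∀ s t h, covariance (X (s + h)) (X (t + h)) μ = covariance (X s) (X t) μ
  cov_σ : ∀ s t h, covariance (σ (s + h)) (σ (t + h)) μ = covariance (σ s) (σ t) μ
  cov_X_σ : ∀ s t h, covariance (X (s + h)) (σ (t + h)) μ = covariance (X s) (σ t) μ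

/-- Ergodicity of the strictly stationary bivariate process `(X_t, σ_t)_{t ∈ ℤ}`: the time shift
on `(ℝ × ℝ)^ℤ` is ergodic for the law of the process. -/
def IsErgodicProcess {Ω : Type*} [MeasurableSpace Ω] (μ : Measure Ω) (X σ : ℤ → Ω → ℝ) : Prop :=
  Ergodic (timeShift 1) (μ.map (pairPath X σ))

/-- Index set of the Volterra series: pairs `(k, (j₁, …, j_k))` with `k ≥ 1` and all `j_i ≥ 1`. -/
abbrev VolterraIndex : Type := Σ k : ℕ+, (Fin k → ℕ+)

/-- The term `b_{j₁} ⋯ b_{j_k} ε_{t-j₁} ε_{t-j₁-j₂} ⋯ ε_{t-j₁-⋯-j_k}` of the Volterra series. -/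
noncomputable def volterraTerm {Ω : Type*} (b : ℕ+ → ℝ) (ε : ℤ → Ω → ℝ) (t : ℤ)
    (p : VolterraIndex) (ω : Ω) : ℝ :=
  (∏ i, b (p.2 i)) * ∏ i, ε (t - ∑ l ∈ Finset.Iic i, ((p.2 l : ℕ) : ℤ)) ω

/-- `σ_t = a + a ∑_{k ≥ 1} ∑_{j₁, …, j_k ≥ 1} b_{j₁} ⋯ b_{j_k} ε_{t-j₁} ⋯ ε_{t-j₁-⋯-j_k}` for
every `t`, the multiple series converging unconditionally (along all finite sets of indices, so
for every order of summation) in `L²(μ)`. -/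
def IsVolterraSeries {Ω : Type*} [MeasurableSpace Ω] (μ : Measure Ω) (a : ℝ) (b : ℕ+ → ℝ)
    (ε σ : ℤ → Ω → ℝ) : Prop :=
  ∀ t, Tendsto
    (fun F : Finset VolterraIndex =>
      eLpNorm (fun ω => σ t ω - (a + a * ∑ p ∈ F, volterraTerm b ε t p ω)) 2 μ)
    atTop (𝓝 0)

/-! Index the Volterra monomials by lists of positive lags, the empty list giving the constant 1.
Each innovation is centred, has second moment one and is independent of its past, so distinct
monomials are orthogonal in L² and each has as squared norm the product of its `b j ^ 2`. Lists of
length n contribute (∑ b_j²)^n, so the squared norms form a convergent geometric series and the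
monomials are unconditionally summable. Their sum is one functional G of the past, the same at all
times (`exists_volterra_functional`); set σ_t = a G(past of t) and X_t = ε_t σ_t. Grouping the
nonempty lists by their head turns the series into the LARCH recursion
(`hasSum_larch_of_hasSum_volterra`).

As a shift-equivariant image of the innovations, (X, σ) inherits stationarity and ergodicity from
the Bernoulli shift, which is ergodic because it is mixing. The remainders of ∑ b_j X_{t-j} form a
reverse martingale, so a maximal inequality upgrades L² convergence to almost sure convergence.

For uniqueness, the difference D of two solutions satisfies the homogeneous equation, and
orthogonality gives sup E D² ≤ (∑ b_j²) sup E D², hence D = 0 (`IsPast.ae_eq_zero_of_homogeneous`).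
The structure `IsPast` serves both the past of the innovations alone and the larger past that
includes a competing solution. -/

/-! ### Mixing and ergodicity of the Bernoulli shift. -/

section Shift

variable {Ω : Type*} [MeasurableSpace Ω] {μ : Measure Ω}

/-- Reindexing an i.i.d. family along injections does not change its law. -/
theorem iid_map_reindex [IsProbabilityMeasure μ] {ι κ : Type*} {ε : ι → Ω → ℝ}
    (hm : ∀ t, Measurable (ε t)) (hi : iIndepFun ε μ)
    (hd : ∀ s t, IdentDistrib (ε s) (ε t) μ μ) {e e' : κ → ι}
    (he : Function.Injective e) (he' : Function.Injective e') :
    μ.map (fun ω k => ε (e k) ω) = μ.map (fun ω k => ε (e' k) ω) := by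
  have h1 := (hi.precomp he).map_fun_eq_infinitePi_map (fun k => hm (e k))
  have h2 := (hi.precomp he').map_fun_eq_infinitePi_map (fun k => hm (e' k))
  rw [h1, h2]
  congr 1
  ext1 k
  exact (hd (e k) (e' k)).map_eq

theorem measurable_timeShift {E : Type*} [MeasurableSpace E] (h : ℤ) :
    Measurable (timeShift h : (ℤ → E) → ℤ → E) :=
  measurable_pi_iff.2 fun t => measurable_pi_apply (t + h)

theorem timeShift_iterate {E : Type*} (n : ℕ) :
    (timeShift 1 : (ℤ → E) → ℤ → E)^[n] = timeShift n := by
  induction n with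
  | zero => funext x t; simp [timeShift]
  | succ n ih =>
    rw [Function.iterate_succ', ih]
    funext x t
    simp only [Function.comp_apply, timeShift]
    congr 1
    push_cast
    ring

/-- If the events of a generating `π`-system are asymptotically independent of the images of a
fixed event along a sequence of measure-preserving maps, so are all events. -/
theorem tendsto_measure_inter_preimage_of_piSystem {α : Type*} [m : MeasurableSpace α]
    {ν : Measure α} [IsProbabilityMeasure ν] {T : ℕ → α → α}
    (hT : ∀ n, MeasurePreserving (T n) ν ν) {C : Set (Set α)} (hC : IsPiSystem C)
    (hgen : m = MeasurableSpace.generateFrom C) {A : Set α} (hA : MeasurableSet A)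
    (h : ∀ B ∈ C, Tendsto (fun n => ν.real (A ∩ T n ⁻¹' B)) atTop (𝓝 (ν.real A * ν.real B)))
    {B : Set α} (hB : MeasurableSet B) :
    Tendsto (fun n => ν.real (A ∩ T n ⁻¹' B)) atTop (𝓝 (ν.real A * ν.real B)) := by
  induction B, hB using MeasurableSpace.induction_on_inter hgen hC with
  | empty => simp
  | basic B hB => exact h B hB
  | compl B hB ih =>
    have e : ∀ n, ν.real (A ∩ T n ⁻¹' Bᶜ) = ν.real A - ν.real (A ∩ T n ⁻¹' B) := fun n => by
      have := measureReal_inter_add_sdiff (μ := ν) (s := A) ((hT n).measurable hB)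
      rw [Set.preimage_compl, ← Set.sdiff_eq]
      linarith
    simp_rw [e]
    rw [measureReal_compl hB, probReal_univ, mul_sub, mul_one]
    exact tendsto_const_nhds.sub ih
  | iUnion f hd hm ih =>
    have e : ∀ n, ν.real (A ∩ T n ⁻¹' ⋃ i, f i) = ∑' i, ν.real (A ∩ T n ⁻¹' f i) := fun n => by
      rw [Set.preimage_iUnion, Set.inter_iUnion, measureReal_def, measure_iUnion,
        ENNReal.tsum_toReal_eq (fun _ => measure_ne_top _ _)]
      · rfl
      · intro i j hij
        exact ((hd hij).preimage (T n)).mono Set.inter_subset_right Set.inter_subset_right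
      · exact fun i => hA.inter ((hT n).measurable (hm i))
    have hsum : Summable fun i => ν.real (f i) :=
      ENNReal.summable_toReal (by
        rw [← measure_iUnion hd hm]; exact measure_ne_top _ _)
    have e' : ν.real A * ν.real (⋃ i, f i) = ∑' i, ν.real A * ν.real (f i) := by
      rw [tsum_mul_left, measureReal_def ν (⋃ i, f i), measure_iUnion hd hm,
        ENNReal.tsum_toReal_eq (fun _ => measure_ne_top _ _)]
      rfl
    simp_rw [e]
    rw [e']
    refine tendsto_tsum_of_dominated_convergence hsum ih (Eventually.of_forall fun n i => ?_)
    rw [Real.norm_of_nonneg measureReal_nonneg]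
    calc ν.real (A ∩ T n ⁻¹' f i) ≤ ν.real (T n ⁻¹' f i) :=
          measureReal_mono Set.inter_subset_right
      _ = ν.real (f i) := by
          rw [measureReal_def, (hT n).measure_preimage (hm i).nullMeasurableSet]; rfl

/-- The same statement with the roles of the two events exchanged. -/
theorem tendsto_measure_inter_preimage_of_piSystem' {α : Type*} [m : MeasurableSpace α]
    {ν : Measure α} [IsProbabilityMeasure ν] {T : ℕ → α → α}
    (hT : ∀ n, MeasurePreserving (T n) ν ν) {C : Set (Set α)} (hC : IsPiSystem C)
    (hgen : m = MeasurableSpace.generateFrom C) {B : Set α} (hB : MeasurableSet B)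
    (h : ∀ A ∈ C, Tendsto (fun n => ν.real (A ∩ T n ⁻¹' B)) atTop (𝓝 (ν.real A * ν.real B)))
    {A : Set α} (hA : MeasurableSet A) :
    Tendsto (fun n => ν.real (A ∩ T n ⁻¹' B)) atTop (𝓝 (ν.real A * ν.real B)) := by
  induction A, hA using MeasurableSpace.induction_on_inter hgen hC with
  | empty => simp
  | basic A hA => exact h A hA
  | compl A hA ih =>
    have e : ∀ n, ν.real (Aᶜ ∩ T n ⁻¹' B) = ν.real B - ν.real (A ∩ T n ⁻¹' B) := fun n => by
      have h1 : ν.real (T n ⁻¹' B) = ν.real B := by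
        rw [measureReal_def, (hT n).measure_preimage hB.nullMeasurableSet]; rfl
      have := measureReal_inter_add_sdiff (μ := ν) (s := T n ⁻¹' B) hA
      rw [Set.inter_comm A, Set.inter_comm Aᶜ, ← Set.sdiff_eq]
      linarith
    simp_rw [e]
    rw [measureReal_compl hA, probReal_univ, sub_mul, one_mul]
    exact tendsto_const_nhds.sub ih
  | iUnion f hd hm ih =>
    have e : ∀ n, ν.real ((⋃ i, f i) ∩ T n ⁻¹' B) = ∑' i, ν.real (f i ∩ T n ⁻¹' B) := fun n => by
      rw [Set.iUnion_inter, measureReal_def, measure_iUnion,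
        ENNReal.tsum_toReal_eq (fun _ => measure_ne_top _ _)]
      · rfl
      · intro i j hij
        exact (hd hij).mono Set.inter_subset_left Set.inter_subset_left
      · exact fun i => (hm i).inter ((hT n).measurable hB)
    have hsum : Summable fun i => ν.real (f i) :=
      ENNReal.summable_toReal (by
        rw [← measure_iUnion hd hm]; exact measure_ne_top _ _)
    have e' : ν.real (⋃ i, f i) * ν.real B = ∑' i, ν.real (f i) * ν.real B := by
      rw [tsum_mul_right, measureReal_def ν (⋃ i, f i), measure_iUnion hd hm,
        ENNReal.tsum_toReal_eq (fun _ => measure_ne_top _ _)]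
      rfl
    simp_rw [e]
    rw [e']
    refine tendsto_tsum_of_dominated_convergence hsum ih (Eventually.of_forall fun n i => ?_)
    rw [Real.norm_of_nonneg measureReal_nonneg]
    exact measureReal_mono Set.inter_subset_left

theorem iid_measurePreserving_timeShift [IsProbabilityMeasure μ] {ε : ℤ → Ω → ℝ}
    (hm : ∀ t, Measurable (ε t)) (hi : iIndepFun ε μ)
    (hd : ∀ s t, IdentDistrib (ε s) (ε t) μ μ) (h : ℤ) :
    MeasurePreserving (timeShift h) (μ.map fun ω t => ε t ω) (μ.map fun ω t => ε t ω) := by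
  refine ⟨measurable_timeShift h, ?_⟩
  rw [Measure.map_map (measurable_timeShift h) (measurable_pi_iff.2 hm)]
  exact iid_map_reindex hm hi hd (e := fun t => t + h) (e' := fun t => t)
    (add_left_injective h) (fun _ _ h => h)

/-- Two cylinders become independent when one of them is shifted far enough. -/
theorem iid_cylinder_inter_preimage_timeShift [IsProbabilityMeasure μ] {ε : ℤ → Ω → ℝ}
    (hm : ∀ t, Measurable (ε t)) (hi : iIndepFun ε μ)
    (hd : ∀ s t, IdentDistrib (ε s) (ε t) μ μ) {A B : Set (ℤ → ℝ)}
    (hA : A ∈ measurableCylinders (fun _ : ℤ => ℝ))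
    (hB : B ∈ measurableCylinders (fun _ : ℤ => ℝ)) :
    ∀ᶠ n : ℕ in atTop, (μ.map fun ω t => ε t ω).real (A ∩ timeShift (n : ℤ) ⁻¹' B) =
      (μ.map fun ω t => ε t ω).real A * (μ.map fun ω t => ε t ω).real B := by
  have hpath : Measurable fun ω t => ε t ω := measurable_pi_iff.2 hm
  have hAm : MeasurableSet A := .of_mem_measurableCylinders hA
  have hBm : MeasurableSet B := .of_mem_measurableCylinders hB
  obtain ⟨I, S, hS, rfl⟩ := (mem_measurableCylinders A).1 hA
  obtain ⟨J, R, hR, rfl⟩ := (mem_measurableCylinders B).1 hB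
  obtain ⟨M, hM⟩ := I.bddAbove
  obtain ⟨N, hN⟩ := J.bddBelow
  -- The shifted cylinder depends on the coordinates in `J + n`; beyond this threshold they all
  -- exceed `M`, the upper bound of `I`.
  filter_upwards [eventually_gt_atTop (M - N).toNat] with n hn
  have hp := iid_measurePreserving_timeShift hm hi hd n
  simp only [measureReal_def]
  rw [← hp.measure_preimage hBm.nullMeasurableSet,
    Measure.map_apply hpath (hAm.inter (hp.measurable hBm)), Measure.map_apply hpath hAm,
    Measure.map_apply hpath (hp.measurable hBm), ← ENNReal.toReal_mul]
  congr 1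
  let J' : Finset ℤ := J.image (· + (n : ℤ))
  have hdisj : Disjoint I J' := by
    rw [Finset.disjoint_left]
    intro x hx hx'
    obtain ⟨y, hy, rfl⟩ := Finset.mem_image.1 hx'
    have h1 := hM hx
    have h2 := hN hy
    omega
  have hind := hi.indepFun_finset I J' hdisj hm
  let φ : (J' → ℝ) → (J → ℝ) := fun y j =>
    y ⟨j + n, Finset.mem_image_of_mem (· + (n : ℤ)) j.2⟩
  have hφ : Measurable φ := by fun_prop
  exact hind.measure_inter_preimage_eq_mul S (φ ⁻¹' R) hS (hφ hR)

/-- The two-sided Bernoulli shift is ergodic. -/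
theorem iid_ergodic_timeShift [IsProbabilityMeasure μ] {ε : ℤ → Ω → ℝ}
    (hm : ∀ t, Measurable (ε t)) (hi : iIndepFun ε μ)
    (hd : ∀ s t, IdentDistrib (ε s) (ε t) μ μ) :
    Ergodic (timeShift 1) (μ.map fun ω t => ε t ω) := by
  have hpath : Measurable fun ω t => ε t ω := measurable_pi_iff.2 hm
  set ν := μ.map fun ω t => ε t ω with hν
  have : IsProbabilityMeasure ν := Measure.isProbabilityMeasure_map hpath.aemeasurable
  have hT : ∀ n : ℕ, MeasurePreserving (timeShift (n : ℤ)) ν ν :=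
    fun n => iid_measurePreserving_timeShift hm hi hd n
  have hgen := (generateFrom_measurableCylinders (α := fun _ : ℤ => ℝ)).symm
  have hpi := isPiSystem_measurableCylinders (α := fun _ : ℤ => ℝ)
  refine ⟨iid_measurePreserving_timeShift hm hi hd 1, ⟨fun s hs hs' => ?_⟩⟩
  have hinv : ∀ n : ℕ, timeShift (n : ℤ) ⁻¹' s = s := fun n => by
    rw [← timeShift_iterate, Set.preimage_iterate_eq]
    exact Function.iterate_fixed hs' n
  have hlim : Tendsto (fun n : ℕ => ν.real (s ∩ timeShift (n : ℤ) ⁻¹' s)) atTop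
      (𝓝 (ν.real s * ν.real s)) := by
    -- Mixing passes from cylinders to `s` one argument at a time: the shifted event here, the fixed
    -- one in the next step.
    refine tendsto_measure_inter_preimage_of_piSystem hT hpi hgen hs (fun B hB => ?_) hs
    refine tendsto_measure_inter_preimage_of_piSystem' hT hpi hgen
      (.of_mem_measurableCylinders hB) (fun A hA => ?_) hs
    exact tendsto_const_nhds.congr'
      ((iid_cylinder_inter_preimage_timeShift hm hi hd hA hB).mono fun n h => h.symm)
  simp only [hinv, Set.inter_self] at hlim
  -- Mixing applied to an invariant set gives ν(s) = ν(s)².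
  have hsq : ν.real s = ν.real s * ν.real s := tendsto_nhds_unique tendsto_const_nhds hlim
  have h01 : ν.real s = 0 ∨ ν.real s = 1 := by
    by_cases h0 : ν.real s = 0
    · exact Or.inl h0
    · exact Or.inr (mul_left_cancel₀ h0 (by linarith))
  rw [Filter.eventuallyConst_set']
  rcases h01 with h | h
  · left
    rw [measureReal_eq_zero_iff] at h
    exact ae_eq_empty.2 h
  · right
    refine ae_eq_univ.2 ((prob_compl_eq_zero_iff hs).2 ?_)
    rw [← ENNReal.ofReal_one, ← h, ofReal_measureReal]

end Shift

/-! ### Almost sure convergence of reverse martingales. -/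

section ReverseMartingale

variable {Ω : Type*} {m0 : MeasurableSpace Ω} {μ : Measure Ω}

/-- Doob's maximal inequality for the reverse martingale `n ↦ E[f | m n]`, up to time `N + k`. -/
theorem condExp_antitone_maximal_ineq [IsFiniteMeasure μ] {m : ℕ → MeasurableSpace Ω}
    (hm : Antitone m) (hle : ∀ n, m n ≤ m0) (f : Ω → ℝ) (c : NNReal) (N k : ℕ) :
    c * μ {ω | ∃ i ≤ k, (c : ℝ) ≤ |(μ[f|m (N + i)]) ω|} ≤
      ENNReal.ofReal (∫ ω, |(μ[f|m N]) ω| ∂μ) := by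
  -- Time is reversed on the window from `N` to `N + k`. Truncated subtraction freezes the
  -- filtration at `m N` from time `k` on.
  let ℱ : Filtration ℕ m0 :=
    ⟨fun i => m (N + (k - i)), fun i j hij => hm (by omega), fun i => hle _⟩
  have hM : Martingale (fun i => μ[f|ℱ i]) ℱ μ := martingale_condExp f ℱ μ
  -- The absolute value is the supremum of the martingale and its negative, hence a nonnegative
  -- submartingale.
  have hsub := hM.submartingale.sup hM.neg.submartingale
  have hmax := maximal_ineq (ε := c) hsub
    (fun i ω => by
      simp only [Pi.sup_apply, Pi.zero_apply, Pi.neg_apply]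
      exact abs_nonneg ((μ[f|ℱ i]) ω)) k
  have hset : {ω | ∃ i ≤ k, (c : ℝ) ≤ |(μ[f|m (N + i)]) ω|} ⊆
      {ω | (c : ℝ) ≤ (Finset.range (k + 1)).sup' Finset.nonempty_range_add_one
        fun i => ((fun i => μ[f|ℱ i]) ⊔ -fun i => μ[f|ℱ i]) i ω} := by
    rintro ω ⟨i, hi, h⟩
    simp only [Set.mem_ofPred_eq, Finset.le_sup'_iff, Finset.mem_range]
    refine ⟨k - i, by omega, ?_⟩
    have : k - (k - i) = i := by omega
    change (c : ℝ) ≤ |(μ[f|m (N + (k - (k - i)))]) ω|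
    rwa [this]
  refine (mul_le_mul_right (measure_mono hset) _).trans (hmax.trans ?_)
  refine ENNReal.ofReal_le_ofReal ?_
  have e : ((fun i => μ[f|ℱ i]) ⊔ -fun i => μ[f|ℱ i]) k = fun ω => |(μ[f|m N]) ω| := by
    funext ω
    change |(μ[f|m (N + (k - k))]) ω| = _
    simp
  rw [e]
  exact setIntegral_le_integral integrable_condExp.abs (ae_of_all _ fun ω => abs_nonneg _)

/-- A reverse martingale that tends to zero in `L¹` tends to zero almost surely. -/
theorem tendsto_ae_condExp_antitone_of_tendsto_integral_abs [IsFiniteMeasure μ]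
    {m : ℕ → MeasurableSpace Ω} (hm : Antitone m) (hle : ∀ n, m n ≤ m0) (f : Ω → ℝ)
    (h : Tendsto (fun n => ∫ ω, |(μ[f|m n]) ω| ∂μ) atTop (𝓝 0)) :
    ∀ᵐ ω ∂μ, Tendsto (fun n => (μ[f|m n]) ω) atTop (𝓝 0) := by
  have hmax : ∀ (c : NNReal) (N : ℕ), c * μ {ω | ∃ i, (c : ℝ) ≤ |(μ[f|m (N + i)]) ω|} ≤
      ENNReal.ofReal (∫ ω, |(μ[f|m N]) ω| ∂μ) := by
    intro c N
    have e : {ω | ∃ i, (c : ℝ) ≤ |(μ[f|m (N + i)]) ω|} =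
        ⋃ k, {ω | ∃ i ≤ k, (c : ℝ) ≤ |(μ[f|m (N + i)]) ω|} := by
      ext ω
      simp only [Set.mem_ofPred_eq, Set.mem_iUnion]
      exact ⟨fun ⟨i, hi⟩ => ⟨i, i, le_rfl, hi⟩, fun ⟨k, i, _, hi⟩ => ⟨i, hi⟩⟩
    have hmono : Monotone fun k => {ω | ∃ i ≤ k, (c : ℝ) ≤ |(μ[f|m (N + i)]) ω|} :=
      fun k l hkl ω ⟨i, hi, h⟩ => ⟨i, hi.trans hkl, h⟩
    rw [e, hmono.measure_iUnion, ENNReal.mul_iSup]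
    exact iSup_le fun k => condExp_antitone_maximal_ineq hm hle f c N k
  have hnull : ∀ q : ℕ,
      μ {ω | ∀ N, ∃ i, (((q + 1 : NNReal)⁻¹ : NNReal) : ℝ) ≤ |(μ[f|m (N + i)]) ω|} = 0 := by
    intro q
    set c : NNReal := (q + 1 : NNReal)⁻¹
    have hc : (c : ENNReal) ≠ 0 := by simp [c]
    -- The event that level `c` is exceeded infinitely often lies in every tail event, whose bound
    -- tends to 0 with `N`.
    have hle' : ∀ N, c * μ {ω | ∀ N, ∃ i, (c : ℝ) ≤ |(μ[f|m (N + i)]) ω|} ≤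
        ENNReal.ofReal (∫ ω, |(μ[f|m N]) ω| ∂μ) := fun N =>
      (mul_le_mul_right (measure_mono fun ω hω => by
        rw [Set.mem_ofPred_eq] at hω ⊢
        exact hω N) _).trans (hmax c N)
    have hlim : Tendsto (fun N => ENNReal.ofReal (∫ ω, |(μ[f|m N]) ω| ∂μ)) atTop (𝓝 0) := by
      simpa using ENNReal.tendsto_ofReal h
    have h0 := le_antisymm (ge_of_tendsto' hlim hle') zero_le
    exact (mul_eq_zero.1 h0).resolve_left hc
  have hae := ae_all_iff.2 fun q : ℕ => measure_eq_zero_iff_ae_notMem.1 (hnull q)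
  filter_upwards [hae] with ω hω
  rw [Metric.tendsto_atTop]
  intro δ hδ
  obtain ⟨q, hq⟩ := exists_nat_one_div_lt hδ
  have := hω q
  simp only [not_forall, not_exists, not_le] at this
  obtain ⟨N, hN⟩ := this
  refine ⟨N, fun n hn => ?_⟩
  obtain ⟨i, rfl⟩ := Nat.exists_eq_add_of_le hn
  rw [Real.dist_eq, sub_zero]
  refine (hN i).trans ?_
  simpa using hq

end ReverseMartingale

/-! ### Orthogonality with respect to a past, and the homogeneous equation. -/

section Driven

variable {Ω : Type*} {m0 : MeasurableSpace Ω} {μ : Measure Ω}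

theorem eLpNorm_two_sq_eq_lintegral (f : Ω → ℝ) :
    eLpNorm f 2 μ ^ 2 = ∫⁻ ω, ‖f ω‖ₑ ^ 2 ∂μ := by
  have h := eLpNorm_nnreal_pow_eq_lintegral (f := f) (μ := μ) (p := 2) two_ne_zero
  simpa using h

theorem MeasureTheory.MemLp.eLpNorm_two_sq_eq_ofReal {f : Ω → ℝ} (hf : MemLp f 2 μ) :
    eLpNorm f 2 μ ^ 2 = ENNReal.ofReal (∫ ω, f ω ^ 2 ∂μ) := by
  rw [ofReal_integral_eq_lintegral_ofReal hf.integrable_sq (ae_of_all _ fun ω => sq_nonneg _),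
    eLpNorm_two_sq_eq_lintegral]
  refine lintegral_congr fun ω => ?_
  rw [Real.enorm_eq_ofReal_abs, ← ENNReal.ofReal_pow (abs_nonneg _), sq_abs]

/-- The limit in measure of a sequence of functions measurable with respect to a sub-`σ`-algebra
is almost surely equal to a function measurable with respect to it. -/
theorem aestronglyMeasurable_of_tendstoInMeasure {m : MeasurableSpace Ω} {f : ℕ → Ω → ℝ}
    {g : Ω → ℝ} (hf : ∀ n, AEStronglyMeasurable[m] (f n) μ)
    (h : TendstoInMeasure μ f atTop g) : AEStronglyMeasurable[m] g μ := by
  obtain ⟨ns, -, hns⟩ := h.exists_seq_tendsto_ae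
  choose f' hf' hff' using hf
  refine ⟨fun ω => limsup (fun i => f' (ns i) ω) atTop,
    (Measurable.limsup fun i => (hf' (ns i)).measurable).stronglyMeasurable, ?_⟩
  filter_upwards [hns, ae_all_iff.2 hff'] with ω h1 h2
  simp only [h2] at h1
  exact h1.limsup_eq.symm

theorem IsInnovation.memLp {ε : ℤ → Ω → ℝ} (hε : IsInnovation μ ε) (t : ℤ) :
    MemLp (ε t) 2 μ := by
  rw [memLp_two_iff_integrable_sq (hε.measurable t).aestronglyMeasurable]
  -- The integral of a nonintegrable function is 0 by convention, so the value 1 forces square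
  -- integrability.
  by_contra h
  have := hε.second_moment t
  rw [integral_undef h] at this
  exact zero_ne_one this

theorem IsInnovation.lintegral_sq {ε : ℤ → Ω → ℝ} (hε : IsInnovation μ ε) (t : ℤ) :
    ∫⁻ ω, ‖ε t ω‖ₑ ^ 2 ∂μ = 1 := by
  rw [← eLpNorm_two_sq_eq_lintegral, (hε.memLp t).eLpNorm_two_sq_eq_ofReal,
    hε.second_moment, ENNReal.ofReal_one]

/-- `ℱ t` is a past at time `t`: it contains the innovations before `t`, and is independent of the
innovation at time `t`. -/
structure IsPast (μ : Measure Ω) (ε : ℤ → Ω → ℝ) (ℱ : ℤ → MeasurableSpace Ω) : Prop where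
  le : ∀ t, ℱ t ≤ m0
  mono : Monotone ℱ
  measurable : ∀ s t, s < t → Measurable[ℱ t] (ε s)
  indep : ∀ t, Indep (MeasurableSpace.comap (ε t) inferInstance) (ℱ t) μ

namespace IsPast

variable {ε : ℤ → Ω → ℝ} {ℱ : ℤ → MeasurableSpace Ω}

theorem indepFun (h : IsPast μ ε ℱ) {t : ℤ} {Y : Ω → ℝ} (hY : AEStronglyMeasurable[ℱ t] Y μ) :
    IndepFun (ε t) Y μ := by
  obtain ⟨Y', hY', hYY'⟩ := hY
  refine IndepFun.congr (f := ε t) (g := Y') ?_ .rfl hYY'.symm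
  rw [IndepFun_iff_Indep]
  exact indep_of_indep_of_le_right (h.indep t) hY'.measurable.comap_le

/-- By independence E(ε_t² Y²) = E ε_t² · E Y². Working with lower integrals, `Y` need not be square
integrable. -/
theorem eLpNorm_mul (h : IsPast μ ε ℱ) (hε : IsInnovation μ ε) {t : ℤ} {Y : Ω → ℝ}
    (hY : AEStronglyMeasurable[ℱ t] Y μ) :
    eLpNorm (fun ω => ε t ω * Y ω) 2 μ = eLpNorm Y 2 μ := by
  have hsq : eLpNorm (fun ω => ε t ω * Y ω) 2 μ ^ 2 = eLpNorm Y 2 μ ^ 2 := by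
    rw [eLpNorm_two_sq_eq_lintegral, eLpNorm_two_sq_eq_lintegral]
    have hφ : Measurable fun x : ℝ => ‖x‖ₑ ^ 2 := by fun_prop
    have := lintegral_mul_eq_lintegral_mul_lintegral_of_indepFun''
      (hφ.comp_aemeasurable (hε.measurable t).aemeasurable)
      (hφ.comp_aemeasurable (hY.mono (h.le t)).aemeasurable) ((h.indepFun hY).comp hφ hφ)
    simp only [Function.comp_apply, hε.lintegral_sq, one_mul] at this
    simpa only [enorm_mul, mul_pow] using this
  exact (ENNReal.pow_right_strictMono two_ne_zero).injective hsq

theorem memLp_mul (h : IsPast μ ε ℱ) (hε : IsInnovation μ ε) {t : ℤ} {Y : Ω → ℝ}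
    (hY : AEStronglyMeasurable[ℱ t] Y μ) (hY2 : MemLp Y 2 μ) :
    MemLp (fun ω => ε t ω * Y ω) 2 μ :=
  ⟨(hε.measurable t).aestronglyMeasurable.mul hY2.1, by
    rw [h.eLpNorm_mul hε hY]; exact hY2.2⟩

/-- The product rule for independent factors holds even if `Y` is not integrable, with the
convention that such integrals vanish. -/
theorem integral_mul (h : IsPast μ ε ℱ) (hε : IsInnovation μ ε) {t : ℤ} {Y : Ω → ℝ}
    (hY : AEStronglyMeasurable[ℱ t] Y μ) : ∫ ω, ε t ω * Y ω ∂μ = 0 := by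
  rw [(h.indepFun hY).integral_fun_mul_eq_mul_integral
    (hε.measurable t).aestronglyMeasurable (hY.mono (h.le t)), hε.mean_zero, zero_mul]

theorem aestronglyMeasurable_mul (h : IsPast μ ε ℱ) {s t : ℤ} (hst : s < t) {Y : Ω → ℝ}
    (hY : AEStronglyMeasurable[ℱ s] Y μ) :
    AEStronglyMeasurable[ℱ t] (fun ω => ε s ω * Y ω) μ :=
  (h.measurable s t hst).stronglyMeasurable.aestronglyMeasurable.mul (hY.mono (h.mono hst.le))

end IsPast

theorem integral_sq_sum_of_orthogonal {D : ℕ → Ω → ℝ} (hD : ∀ i, MemLp (D i) 2 μ)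
    (ho : ∀ i j, i < j → ∫ ω, D i ω * D j ω ∂μ = 0) (n : ℕ) :
    ∫ ω, (∑ i ∈ Finset.range n, D i ω) ^ 2 ∂μ = ∑ i ∈ Finset.range n, ∫ ω, D i ω ^ 2 ∂μ := by
  induction n with
  | zero => simp
  | succ n ih =>
    have hS : MemLp (fun ω => ∑ i ∈ Finset.range n, D i ω) 2 μ := memLp_finsetSum _ fun i _ => hD i
    have hc : ∫ ω, (∑ i ∈ Finset.range n, D i ω) * D n ω ∂μ = 0 := by
      simp_rw [Finset.sum_mul]
      rw [integral_finsetSum (f := fun i ω => D i ω * D n ω) _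
        fun i _ => (hD i).integrable_mul (hD n)]
      exact Finset.sum_eq_zero fun i hi => ho i n (Finset.mem_range.1 hi)
    have hint : Integrable (fun ω => (∑ i ∈ Finset.range n, D i ω) * D n ω) μ :=
      hS.integrable_mul (hD n)
    have e : ∀ ω, (∑ i ∈ Finset.range (n + 1), D i ω) ^ 2 =
        (∑ i ∈ Finset.range n, D i ω) ^ 2 + 2 * ((∑ i ∈ Finset.range n, D i ω) * D n ω) +
          D n ω ^ 2 := fun ω => by
      rw [Finset.sum_range_succ]; ring
    simp_rw [e]
    rw [integral_add (f := fun ω => (∑ i ∈ Finset.range n, D i ω) ^ 2 +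
        2 * ((∑ i ∈ Finset.range n, D i ω) * D n ω))
        (hS.integrable_sq.add (hint.const_mul 2)) (hD n).integrable_sq,
      integral_add hS.integrable_sq (hint.const_mul 2), integral_const_mul, hc, ih,
      Finset.sum_range_succ]
    ring

/-- The homogeneous LARCH equation has no nonzero causal solution that is bounded in `L²`. -/
theorem IsPast.ae_eq_zero_of_homogeneous {ε : ℤ → Ω → ℝ} {ℱ : ℤ → MeasurableSpace Ω}
    (h : IsPast μ ε ℱ) (hε : IsInnovation μ ε) {b : ℕ+ → ℝ} (hb : Summable fun j => b j ^ 2)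
    (hb1 : ∑' j, b j ^ 2 < 1) {D δ : ℤ → Ω → ℝ} (hD : ∀ t, D t =ᵐ[μ] fun ω => ε t ω * δ t ω)
    (hDm : ∀ s t, s < t → AEStronglyMeasurable[ℱ t] (D s) μ) (hD2 : ∀ t, MemLp (D t) 2 μ) {C : ℝ}
    (hC : ∀ t, ∫ ω, D t ω ^ 2 ∂μ ≤ C)
    (hδ : ∀ t, TendstoInMeasure μ
      (fun n ω => ∑ i ∈ Finset.range n, b i.succPNat * D (t - (i + 1)) ω) atTop (δ t)) (t : ℤ) :
    D t =ᵐ[μ] 0 ∧ δ t =ᵐ[μ] 0 := by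
  have hδm : ∀ t, AEStronglyMeasurable[ℱ t] (δ t) μ := fun t => by
    refine aestronglyMeasurable_of_tendstoInMeasure (fun n => ?_) (hδ t)
    induction n with
    | zero => simpa using aestronglyMeasurable_const
    | succ n ih =>
      simp_rw [Finset.sum_range_succ]
      exact ih.add ((hDm (t - (n + 1)) t (by omega)).const_mul _)
  -- The later variable is its centred innovation times a quantity known from the past, and the
  -- earlier variable belongs to that past.
  have ho : ∀ s t, s < t → ∫ ω, D s ω * D t ω ∂μ = 0 := fun s t hst => by
    rw [← h.integral_mul hε ((hDm s t hst).mul (hδm t))]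
    refine integral_congr_ae ?_
    filter_upwards [hD t] with ω hω
    rw [hω, Pi.mul_apply]
    ring
  have hsum : Summable fun i : ℕ => b i.succPNat ^ 2 :=
    hb.comp_injective Nat.succPNat_injective
  have hsum_eq : ∑' i : ℕ, b i.succPNat ^ 2 = ∑' j, b j ^ 2 :=
    Equiv.tsum_eq Equiv.pnatEquivNat.symm fun j => b j ^ 2
  set B := ∑' j, b j ^ 2
  have hB : 0 ≤ B := tsum_nonneg fun j => sq_nonneg _
  have hδ2 : ∀ M : ℝ, (∀ t, ∫ ω, D t ω ^ 2 ∂μ ≤ M) → ∀ t,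
      eLpNorm (δ t) 2 μ ^ 2 ≤ ENNReal.ofReal (B * M) := by
    intro M hM t
    have hM0 : 0 ≤ M := (integral_nonneg fun ω => sq_nonneg (D t ω)).trans (hM t)
    have hP2 : ∀ i : ℕ, MemLp (fun ω => b i.succPNat * D (t - (i + 1)) ω) 2 μ :=
      fun i => (hD2 _).const_mul _
    -- Orthogonality bounds the norms of the partial sums, and Fatou's lemma carries the bound to a
    -- limit in measure.
    have hle : eLpNorm (δ t) 2 μ ≤ ENNReal.ofReal (B * M) ^ (2⁻¹ : ℝ) := by
      refine eLpNorm_le_of_tendstoInMeasure (Eventually.of_forall fun n => ?_) (hδ t)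
        fun n => (memLp_finsetSum _ fun i _ => hP2 i).1
      rw [ENNReal.le_rpow_inv_iff two_pos, ENNReal.rpow_two,
        (memLp_finsetSum _ fun i _ => hP2 i).eLpNorm_two_sq_eq_ofReal,
        integral_sq_sum_of_orthogonal hP2]
      · refine ENNReal.ofReal_le_ofReal ?_
        calc ∑ i ∈ Finset.range n, ∫ ω, (b i.succPNat * D (t - (i + 1)) ω) ^ 2 ∂μ
            ≤ ∑ i ∈ Finset.range n, b i.succPNat ^ 2 * M := by
              refine Finset.sum_le_sum fun i _ => ?_
              simp_rw [mul_pow]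
              rw [integral_const_mul]
              exact mul_le_mul_of_nonneg_left (hM _) (sq_nonneg _)
          _ = (∑ i ∈ Finset.range n, b i.succPNat ^ 2) * M := by rw [Finset.sum_mul]
          _ ≤ B * M := by
              refine mul_le_mul_of_nonneg_right ?_ hM0
              rw [← hsum_eq]
              exact hsum.sum_le_tsum _ fun i _ => sq_nonneg _
      · intro i j hij
        have e : ∀ ω, b i.succPNat * D (t - (i + 1)) ω * (b j.succPNat * D (t - (j + 1)) ω) =
            b i.succPNat * b j.succPNat * (D (t - (j + 1)) ω * D (t - (i + 1)) ω) :=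
          fun ω => by ring
        simp_rw [e]
        rw [integral_const_mul, ho _ _ (by omega), mul_zero]
    rwa [ENNReal.le_rpow_inv_iff two_pos, ENNReal.rpow_two] at hle
  -- Contraction: E D_t² = E δ_t² since `ε t` is independent of `δ t`, so any uniform bound `M`
  -- improves to `B * M`.
  have hstep : ∀ M : ℝ, (∀ t, ∫ ω, D t ω ^ 2 ∂μ ≤ M) → ∀ t, ∫ ω, D t ω ^ 2 ∂μ ≤ B * M := by
    intro M hM t
    have hM0 : 0 ≤ M := (integral_nonneg fun ω => sq_nonneg (D t ω)).trans (hM t)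
    have := hδ2 M hM t
    rwa [← h.eLpNorm_mul hε (hδm t), ← eLpNorm_congr_ae (hD t),
      (hD2 t).eLpNorm_two_sq_eq_ofReal, ENNReal.ofReal_le_ofReal_iff (mul_nonneg hB hM0)] at this
  have hiter : ∀ n : ℕ, ∀ t, ∫ ω, D t ω ^ 2 ∂μ ≤ B ^ n * C := by
    intro n
    induction n with
    | zero => simpa using hC
    | succ n ih =>
      intro t
      rw [pow_succ', mul_assoc]
      exact hstep _ ih t
  have hlim : Tendsto (fun n : ℕ => B ^ n * C) atTop (𝓝 0) := by
    simpa using (tendsto_pow_atTop_nhds_zero_of_lt_one hB hb1).mul_const C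
  have hzero : ∀ t, ∫ ω, D t ω ^ 2 ∂μ ≤ 0 := fun t => ge_of_tendsto' hlim fun n => hiter n t
  have hδz : eLpNorm (δ t) 2 μ = 0 := by
    have := hδ2 0 hzero t
    simpa using this
  have hδt : δ t =ᵐ[μ] 0 :=
    (eLpNorm_eq_zero_iff ((hδm t).mono (h.le t)) two_ne_zero).1 hδz
  refine ⟨?_, hδt⟩
  filter_upwards [hD t, hδt] with ω h1 h2
  simp [h1, h2]

end Driven

/-! ### Geometric series over lists. -/

section ListSeries

theorem ENNReal.tsum_prod_pi_fin {α : Type*} (g : α → ENNReal) (n : ℕ) :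
    ∑' v : Fin n → α, ∏ i, g (v i) = (∑' a, g a) ^ n := by
  induction n with
  | zero => simp
  | succ n ih =>
    rw [← (Fin.consEquiv fun _ : Fin (n + 1) => α).tsum_eq, ENNReal.tsum_prod']
    simp [Fin.consEquiv, Fin.prod_univ_succ, ENNReal.tsum_mul_left, ENNReal.tsum_mul_right, ih,
      pow_succ']

theorem ENNReal.tsum_list_prod_map {α : Type*} (g : α → ENNReal) :
    ∑' l : List α, (l.map g).prod = ∑' n : ℕ, (∑' a, g a) ^ n := by
  rw [← List.equivSigmaTuple.symm.tsum_eq, ENNReal.tsum_sigma']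
  refine tsum_congr fun n => ?_
  rw [← ENNReal.tsum_prod_pi_fin]
  refine tsum_congr fun v => ?_
  simp [List.equivSigmaTuple, List.map_ofFn, List.prod_ofFn]

/-- Lists of length n contribute (∑ f)^n, which leaves a geometric series. The rearrangement is done
in `ENNReal`, where it needs no summability. -/
theorem summable_list_prod_map {α : Type*} {f : α → ℝ} (h0 : ∀ a, 0 ≤ f a) (hf : Summable f)
    (h1 : ∑' a, f a < 1) : Summable fun l : List α => (l.map f).prod := by
  have e : ∀ l : List α, (l.map f).prod = ((l.map fun a => ENNReal.ofReal (f a)).prod).toReal := by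
    intro l
    induction l with
    | nil => simp
    | cons a l ih => simp [ih, ENNReal.toReal_mul, h0 a]
  simp_rw [e]
  refine ENNReal.summable_toReal ?_
  rw [ENNReal.tsum_list_prod_map, ENNReal.tsum_geometric,
    ← ENNReal.ofReal_tsum_of_nonneg h0 hf]
  refine ENNReal.inv_ne_top.2 (tsub_pos_of_lt ?_).ne'
  exact ENNReal.ofReal_lt_one.2 h1

/-- This removes the constant term of the empty list, whether the nonempty lists are enumerated by
head and tail or by `VolterraIndex`. -/
theorem HasSum.comp_injective_of_range_eq_compl_singleton {E ι κ : Type*} [AddCommGroup E]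
    [TopologicalSpace E] [IsTopologicalAddGroup E] {f : ι → E} {a : E} (h : HasSum f a) (i₀ : ι)
    {i : κ → ι} (hi : Function.Injective i) (hr : Set.range i = {i₀}ᶜ) :
    HasSum (f ∘ i) (a - f i₀) := by
  classical
  have h' := hasSum_ite_sub_hasSum h i₀
  rw [← hi.hasSum_iff] at h'
  · convert h' using 1
    funext k
    have : i k ≠ i₀ := by
      have := Set.mem_range_self (f := i) k
      rwa [hr] at this
    simp [this]
  · intro x hx
    rw [hr, Set.mem_compl_iff, not_not] at hx
    simp [Set.mem_singleton_iff.1 hx]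

end ListSeries

/-! ### Unconditional summation in L². -/

section LpSeries

variable {α : Type*} [MeasurableSpace α] {ν : Measure α}

theorem hasSum_toLp_iff {ι : Type*} {f : ι → α → ℝ} (hf : ∀ i, MemLp (f i) 2 ν) {g : α → ℝ}
    (hg : MemLp g 2 ν) :
    HasSum (fun i => (hf i).toLp (f i)) (hg.toLp g) ↔
      Tendsto (fun F : Finset ι => eLpNorm (fun x => ∑ i ∈ F, f i x - g x) 2 ν) atTop (𝓝 0) := by
  have hF : ∀ F : Finset ι, MemLp (fun x => ∑ i ∈ F, f i x) 2 ν :=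
    fun F => memLp_finsetSum F fun i _ => hf i
  have e : ∀ F : Finset ι, ∑ i ∈ F, (hf i).toLp (f i) = (hF F).toLp _ := by
    intro F
    classical
    induction F using Finset.induction_on with
    | empty => simp; rfl
    | insert a s ha ih =>
      rw [Finset.sum_insert ha, ih, ← MemLp.toLp_add]
      refine MemLp.toLp_congr _ _ (ae_of_all _ fun x => ?_)
      simp [Finset.sum_insert ha]
  rw [HasSum, SummationFilter.unconditional_filter]
  simp_rw [e]
  exact Lp.tendsto_Lp_iff_tendsto_eLpNorm'' _ hF g hg

/-- An orthogonal family in `L²` with summable squared norms is summable. -/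
theorem summable_toLp_of_orthogonal {ι : Type*} {f : ι → α → ℝ} (hf : ∀ i, MemLp (f i) 2 ν)
    (ho : ∀ i j, i ≠ j → ∫ x, f i x * f j x ∂ν = 0)
    (hs : Summable fun i => ∫ x, f i x * f i x ∂ν) :
    Summable fun i => (hf i).toLp (f i) := by
  have hinner : ∀ i j, inner ℝ ((hf i).toLp (f i)) ((hf j).toLp (f j)) =
      ∫ x, f i x * f j x ∂ν := fun i j => by
    rw [L2.inner_def]
    refine integral_congr_ae ?_
    filter_upwards [(hf i).coeFn_toLp, (hf j).coeFn_toLp] with x h1 h2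
    simp [h1, h2, mul_comm]
  set v := fun i => (hf i).toLp (f i)
  -- The Hilbert space criterion concerns orthogonal subspaces; the lines spanned by the vectors
  -- serve, a zero vector spanning a trivial one.
  have hV : OrthogonalFamily ℝ (fun i => Submodule.span ℝ {v i})
      fun i => (Submodule.span ℝ {v i}).subtypeₗᵢ := by
    intro i j hij x y
    obtain ⟨c, hc⟩ := Submodule.mem_span_singleton.1 x.2
    obtain ⟨d, hd⟩ := Submodule.mem_span_singleton.1 y.2
    change inner ℝ (x : Lp ℝ 2 ν) (y : Lp ℝ 2 ν) = 0
    rw [← hc, ← hd, inner_smul_left, inner_smul_right, hinner, ho i j hij]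
    simp
  have := (hV.summable_iff_norm_sq_summable
    fun i => ⟨v i, Submodule.mem_span_singleton_self (v i)⟩).2
  refine this (hs.congr fun i => ?_)
  rw [← hinner, real_inner_self_eq_norm_sq]
  rfl

end LpSeries

/-! ### Orthogonality and summation of the Volterra monomials. -/

section Volterra

variable {Ω : Type*} {ε : ℤ → Ω → ℝ}

/-- The innovations before time `t`, most recent first. -/
def pastPath (ε : ℤ → Ω → ℝ) (t : ℤ) (ω : Ω) : ℕ → ℝ := fun n => ε (t - (n + 1)) ω

/-- The monomial `b_{j₁} ⋯ b_{j_k} y_{j₁} y_{j₁+j₂} ⋯` in the past `y`, where the variables of `y`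
are numbered from zero. -/
def volterraMonomial (b : ℕ+ → ℝ) : List ℕ+ → (ℕ → ℝ) → ℝ
  | [], _ => 1
  | j :: l, y => b j * y j.natPred * volterraMonomial b l fun n => y (n + j)

theorem pastPath_natPred (t : ℤ) (j : ℕ+) (ω : Ω) : pastPath ε t ω j.natPred = ε (t - j) ω := by
  have : ((j.natPred : ℕ) : ℤ) + 1 = j := by exact_mod_cast j.natPred_add_one
  rw [pastPath, this]

theorem pastPath_add (t : ℤ) (k : ℕ) (ω : Ω) :
    (fun n => pastPath ε t ω (n + k)) = pastPath ε (t - k) ω := by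
  funext n
  simp only [pastPath]
  congr 1
  push_cast
  ring

/-- Peeling off the head isolates the latest innovation; the other factor is a functional of the
past before `t - j`, so the two are independent. The inductions on lists rest on this. -/
theorem volterraMonomial_cons_pastPath (b : ℕ+ → ℝ) (j : ℕ+) (l : List ℕ+) (t : ℤ) (ω : Ω) :
    volterraMonomial b (j :: l) (pastPath ε t ω) =
      ε (t - j) ω * (b j * volterraMonomial b l (pastPath ε (t - j) ω)) := by
  rw [volterraMonomial, pastPath_natPred, pastPath_add]
  ring

theorem measurable_volterraMonomial (b : ℕ+ → ℝ) (l : List ℕ+) :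
    Measurable (volterraMonomial b l) := by
  induction l with
  | nil => exact measurable_const
  | cons j l ih =>
    refine (measurable_const.mul (measurable_pi_apply _)).mul (ih.comp ?_)
    exact measurable_pi_iff.2 fun n => measurable_pi_apply (n + (j : ℕ))

theorem measurable_comp_pastPath {G : (ℕ → ℝ) → ℝ} (hG : Measurable G) (t : ℤ) :
    Measurable[MeasurableSpace.comap (pastPath ε t) inferInstance]
      fun ω => G (pastPath ε t ω) :=
  hG.comp (comap_measurable _)

variable [MeasurableSpace Ω] {μ : Measure Ω}

theorem IsInnovation.measurable_pastPath (hε : IsInnovation μ ε) (t : ℤ) :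
    Measurable (pastPath ε t) :=
  measurable_pi_iff.2 fun _ => hε.measurable _

theorem IsInnovation.map_pastPath [IsProbabilityMeasure μ] (hε : IsInnovation μ ε) (s t : ℤ) :
    μ.map (pastPath ε s) = μ.map (pastPath ε t) :=
  iid_map_reindex hε.measurable hε.indep hε.identDistrib
    (e := fun n : ℕ => s - (n + 1)) (e' := fun n : ℕ => t - (n + 1))
    (fun m n h => by simpa using h) (fun m n h => by simpa using h)

theorem IsInnovation.isPast_pastPath (hε : IsInnovation μ ε) :
    IsPast μ ε fun t => MeasurableSpace.comap (pastPath ε t) inferInstance where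
  le t := (hε.measurable_pastPath t).comap_le
  mono s t hst := by
    obtain ⟨k, rfl⟩ : ∃ k : ℕ, s = t - k := ⟨(t - s).toNat, by omega⟩
    have e : pastPath ε (t - k) = (fun y n => y (n + k)) ∘ pastPath ε t :=
      funext fun ω => (pastPath_add t k ω).symm
    beta_reduce
    rw [e, ← MeasurableSpace.comap_comp]
    refine MeasurableSpace.comap_mono (Measurable.comap_le ?_)
    exact measurable_pi_iff.2 fun n => measurable_pi_apply (n + k)
  measurable s t hst := by
    have e : ε s = (fun y => y (t - s - 1).toNat) ∘ pastPath ε t := by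
      funext ω
      simp only [Function.comp_apply, pastPath]
      congr 1
      omega
    rw [e]
    exact (measurable_pi_apply _).comp (comap_measurable _)
  indep t := by
    have h := indep_iSup_of_disjoint (fun s => (hε.measurable s).comap_le)
      ((iIndepFun_iff_iIndep _ _ _).1 hε.indep) (S := {t}) (T := Set.Iio t) (by simp)
    refine indep_of_indep_of_le_left (indep_of_indep_of_le_right h ?_) ?_
    · refine Measurable.comap_le ((@measurable_pi_iff _ _ _ (_) _ _).2 fun n => ?_)
      refine measurable_iff_comap_le.2 ?_
      exact le_iSup₂_of_le (t - (n + 1)) (Set.mem_Iio.2 (by omega)) le_rfl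
    · exact le_iSup₂_of_le t (Set.mem_singleton t) le_rfl

theorem aestronglyMeasurable_comp_pastPath {G : (ℕ → ℝ) → ℝ} (hG : Measurable G) (t : ℤ) :
    AEStronglyMeasurable[MeasurableSpace.comap (pastPath ε t) inferInstance]
      (fun ω => G (pastPath ε t ω)) μ :=
  (measurable_comp_pastPath hG t).stronglyMeasurable.aestronglyMeasurable

theorem IsPast.integral_sq_mul {ℱ : ℤ → MeasurableSpace Ω} (h : IsPast μ ε ℱ)
    (hε : IsInnovation μ ε) {t : ℤ} {Y : Ω → ℝ} (hY : AEStronglyMeasurable[ℱ t] Y μ) :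
    ∫ ω, ε t ω ^ 2 * Y ω ∂μ = ∫ ω, Y ω ∂μ := by
  have hφ : Measurable fun x : ℝ => x ^ 2 := by fun_prop
  have := ((h.indepFun hY).comp hφ measurable_id).integral_fun_mul_eq_mul_integral
    (hφ.comp (hε.measurable t)).aestronglyMeasurable (hY.mono (h.le t))
  simpa [hε.second_moment] using this

theorem memLp_volterraMonomial [IsProbabilityMeasure μ] (hε : IsInnovation μ ε) (b : ℕ+ → ℝ)
    (l : List ℕ+) (t : ℤ) : MemLp (fun ω => volterraMonomial b l (pastPath ε t ω)) 2 μ := by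
  induction l generalizing t with
  | nil => exact memLp_const 1
  | cons j l ih =>
    simp_rw [volterraMonomial_cons_pastPath]
    exact hε.isPast_pastPath.memLp_mul hε
      ((aestronglyMeasurable_comp_pastPath (measurable_volterraMonomial b l) _).const_mul _)
      ((ih _).const_mul _)

theorem integral_volterraMonomial_cons_mul_eq_zero (hε : IsInnovation μ ε) (b : ℕ+ → ℝ)
    (j : ℕ+) (l : List ℕ+) (t : ℤ) {Y : Ω → ℝ}
    (hY : AEStronglyMeasurable[MeasurableSpace.comap (pastPath ε (t - j)) inferInstance] Y μ) :
    ∫ ω, volterraMonomial b (j :: l) (pastPath ε t ω) * Y ω ∂μ = 0 := by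
  simp_rw [volterraMonomial_cons_pastPath, mul_assoc]
  exact hε.isPast_pastPath.integral_mul hε
    (((aestronglyMeasurable_comp_pastPath (measurable_volterraMonomial b l) _).mul hY).const_mul _)

/-- If the heads differ, the smaller lag carries an innovation later than everything else in the
product, so the mean is 0. Equal heads produce a squared innovation of mean 1, which factors out and
leaves the tails. -/
theorem integral_volterraMonomial_mul [IsProbabilityMeasure μ] (hε : IsInnovation μ ε)
    (b : ℕ+ → ℝ) (l l' : List ℕ+) (t : ℤ) :
    ∫ ω, volterraMonomial b l (pastPath ε t ω) * volterraMonomial b l' (pastPath ε t ω) ∂μ =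
      if l = l' then (l.map fun j => b j ^ 2).prod else 0 := by
  have hlt : ∀ (j j' : ℕ+) (l l' : List ℕ+) (t : ℤ), j < j' →
      ∫ ω, volterraMonomial b (j :: l) (pastPath ε t ω) *
        volterraMonomial b (j' :: l') (pastPath ε t ω) ∂μ = 0 := by
    intro j j' l l' t hjj'
    refine integral_volterraMonomial_cons_mul_eq_zero hε b j l t ?_
    simp_rw [volterraMonomial_cons_pastPath b j']
    have : (j : ℕ) < j' := hjj'
    exact hε.isPast_pastPath.aestronglyMeasurable_mul (by omega)
      ((aestronglyMeasurable_comp_pastPath (measurable_volterraMonomial b l') _).const_mul _)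
  induction l generalizing l' t with
  | nil =>
    cases l' with
    | nil => simp [volterraMonomial]
    | cons j' l' =>
      rw [if_neg (by simp)]
      simp_rw [mul_comm (volterraMonomial b [] _)]
      exact integral_volterraMonomial_cons_mul_eq_zero hε b j' l' t
        (aestronglyMeasurable_const (b := (1 : ℝ)))
  | cons j l ih =>
    cases l' with
    | nil =>
      rw [if_neg (by simp)]
      exact integral_volterraMonomial_cons_mul_eq_zero hε b j l t
        (aestronglyMeasurable_const (b := (1 : ℝ)))
    | cons j' l' =>
      rcases lt_trichotomy j j' with h | rfl | h
      · rw [hlt j j' l l' t h, if_neg]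
        simp [h.ne]
      · have e : ∀ ω, volterraMonomial b (j :: l) (pastPath ε t ω) *
            volterraMonomial b (j :: l') (pastPath ε t ω) =
            ε (t - j) ω ^ 2 * (b j ^ 2 * (volterraMonomial b l (pastPath ε (t - j) ω) *
              volterraMonomial b l' (pastPath ε (t - j) ω))) := fun ω => by
          simp_rw [volterraMonomial_cons_pastPath]
          ring
        simp_rw [e]
        rw [hε.isPast_pastPath.integral_sq_mul (Y := fun ω => b j ^ 2 *
          (volterraMonomial b l (pastPath ε (t - j) ω) *
            volterraMonomial b l' (pastPath ε (t - j) ω))) hε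
          (((aestronglyMeasurable_comp_pastPath (measurable_volterraMonomial b l) _).mul
            (aestronglyMeasurable_comp_pastPath (measurable_volterraMonomial b l') _)).const_mul _),
          integral_const_mul, ih]
        simp
      · simp_rw [mul_comm (volterraMonomial b (j :: l) _)]
        rw [hlt j' j l' l t h, if_neg]
        simp [h.ne']

/-- The sum of all Volterra monomials in `L²`, as a functional of the past. -/
theorem exists_volterra_functional [IsProbabilityMeasure μ] (hε : IsInnovation μ ε) {b : ℕ+ → ℝ}
    (hb : Summable fun j => b j ^ 2) (hb1 : ∑' j, b j ^ 2 < 1) :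
    ∃ G : (ℕ → ℝ) → ℝ, Measurable G ∧ ∀ t, ∃ hG : MemLp (fun ω => G (pastPath ε t ω)) 2 μ,
      HasSum (fun l => (memLp_volterraMonomial hε b l t).toLp _) (hG.toLp _) := by
  -- All pasts have the same law, so summing once in L² of that law gives one functional valid at
  -- every time.
  set ν := μ.map (pastPath ε 0) with hν
  have hmap : ∀ t, ν = μ.map (pastPath ε t) := fun t => hε.map_pastPath 0 t
  have hmp : ∀ t, MeasurePreserving (pastPath ε t) μ ν :=
    fun t => ⟨hε.measurable_pastPath t, (hmap t).symm⟩
  have hM : ∀ l, MemLp (volterraMonomial b l) 2 ν := fun l => by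
    rw [hν, memLp_map_measure_iff (measurable_volterraMonomial b l).aestronglyMeasurable
      (hε.measurable_pastPath 0).aemeasurable]
    exact memLp_volterraMonomial hε b l 0
  have hint : ∀ l l', ∫ y, volterraMonomial b l y * volterraMonomial b l' y ∂ν =
      if l = l' then (l.map fun j => b j ^ 2).prod else 0 := fun l l' => by
    rw [← integral_volterraMonomial_mul hε b l l' 0, hν,
      integral_map (hε.measurable_pastPath 0).aemeasurable]
    exact ((measurable_volterraMonomial b l).mul
      (measurable_volterraMonomial b l')).aestronglyMeasurable
  have hsum : Summable fun l => (hM l).toLp (volterraMonomial b l) := by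
    refine summable_toLp_of_orthogonal hM (fun l l' h => by rw [hint, if_neg h]) ?_
    simp_rw [hint, if_true]
    exact summable_list_prod_map (fun j => sq_nonneg _) hb hb1
  set G : Lp ℝ 2 ν := ∑' l, (hM l).toLp (volterraMonomial b l) with hGdef
  have hG : MemLp G 2 ν := Lp.memLp G
  have hGm : Measurable G := (Lp.stronglyMeasurable G).measurable
  refine ⟨G, hGm, fun t => ⟨hG.comp_measurePreserving (hmp t), ?_⟩⟩
  have h := hsum.hasSum
  rw [← hGdef, ← Lp.toLp_coeFn G hG, hasSum_toLp_iff] at h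
  rw [hasSum_toLp_iff]
  refine h.congr fun F => ?_
  rw [← eLpNorm_comp_measurePreserving (p := 2) _ (hmp t)]
  · rfl
  · exact ((Finset.measurable_fun_sum F fun l _ => measurable_volterraMonomial b l).sub
      hGm).aestronglyMeasurable

end Volterra

theorem MeasureTheory.TendstoInMeasure.fun_sub {Ω ι : Type*} [MeasurableSpace Ω] {μ : Measure Ω}
    {u : Filter ι} {f f' : ι → Ω → ℝ} {g g' : Ω → ℝ} (h : TendstoInMeasure μ f u g)
    (h' : TendstoInMeasure μ f' u g') :
    TendstoInMeasure μ (fun i ω => f i ω - f' i ω) u fun ω => g ω - g' ω := by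
  rw [tendstoInMeasure_iff_norm] at *
  intro c hc
  have hsum := (h (c / 2) (half_pos hc)).add (h' (c / 2) (half_pos hc))
  rw [add_zero] at hsum
  refine tendsto_of_tendsto_of_tendsto_of_le_of_le tendsto_const_nhds hsum
    (fun _ => zero_le) fun i => (measure_mono ?_).trans (measure_union_le _ _)
  intro ω hω
  rw [Set.mem_union, Set.mem_ofPred_eq, Set.mem_ofPred_eq]
  rw [Set.mem_ofPred_eq] at hω
  by_contra! hcon
  have h1 : f i ω - f' i ω - (g ω - g' ω) = (f i ω - g ω) - (f' i ω - g' ω) := by ring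
  rw [h1] at hω
  linarith [norm_sub_le (f i ω - g ω) (f' i ω - g' ω), hcon.1, hcon.2]

/-! ### Almost sure convergence of the LARCH series. -/

section AlmostSure

variable {Ω : Type*} {m0 : MeasurableSpace Ω} {μ : Measure Ω}

theorem larchPartialSum_succ (a : ℝ) (b : ℕ+ → ℝ) (X : ℤ → Ω → ℝ) (t : ℤ) (n : ℕ) (ω : Ω) :
    larchPartialSum a b X t (n + 1) ω =
      larchPartialSum a b X t n ω + b n.succPNat * X (t - (n + 1)) ω := by
  rw [larchPartialSum, larchPartialSum, Finset.sum_range_succ, add_assoc]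

theorem memLp_larchPartialSum [IsFiniteMeasure μ] (a : ℝ) (b : ℕ+ → ℝ) {X : ℤ → Ω → ℝ}
    (hX : ∀ t, MemLp (X t) 2 μ) (t : ℤ) (n : ℕ) : MemLp (larchPartialSum a b X t n) 2 μ :=
  (memLp_const a).add (memLp_finsetSum _ fun _ _ => (hX _).const_mul _)

/-- The remainder of the series `∑ b_j X_{t-j}` is a reverse martingale. -/
theorem IsPast.sub_larchPartialSum_ae_eq_condExp [IsProbabilityMeasure μ] {ε : ℤ → Ω → ℝ}
    {ℱ : ℤ → MeasurableSpace Ω} (h : IsPast μ ε ℱ) (hε : IsInnovation μ ε) (a : ℝ) (b : ℕ+ → ℝ)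
    {X σ : ℤ → Ω → ℝ} (hX : ∀ t ω, X t ω = ε t ω * σ t ω)
    (hσm : ∀ t, AEStronglyMeasurable[ℱ t] (σ t) μ) (hσ2 : ∀ t, MemLp (σ t) 2 μ) (t : ℤ)
    (hlim : TendstoInMeasure μ (larchPartialSum a b X t) atTop (σ t)) (n : ℕ) :
    (fun ω => σ t ω - larchPartialSum a b X t n ω) =ᵐ[μ] μ[fun ω => σ t ω - a|ℱ (t - n)] := by
  have hXe : ∀ t, X t = fun ω => ε t ω * σ t ω := fun t => funext (hX t)
  have hX2 : ∀ t, MemLp (X t) 2 μ := fun t => by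
    rw [hXe]; exact h.memLp_mul hε (hσm t) (hσ2 t)
  have hP := memLp_larchPartialSum a b hX2 t
  have hR2 : MemLp (fun ω => σ t ω - larchPartialSum a b X t n ω) 2 μ := (hσ2 t).sub (hP n)
  have hf2 : MemLp (fun ω => σ t ω - a) 2 μ := (hσ2 t).sub (memLp_const a)
  refine ae_eq_condExp_of_forall_setIntegral_eq (h.le _) (hf2.integrable one_le_two)
    (fun s _ _ => (hR2.integrable one_le_two).integrableOn) (fun A hA _ => ?_) ?_
  -- The first `n` terms live at times at least `t - n`, so `A` lies in the past of each and its
  -- indicator can be absorbed into `σ`: they have zero conditional expectation.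
  · have hzero : ∀ i : ℕ, i < n → ∫ ω in A, X (t - (i + 1)) ω ∂μ = 0 := by
      intro i hi
      have hA' : MeasurableSet[ℱ (t - (i + 1))] A := h.mono (by omega) A hA
      rw [← integral_indicator (h.le _ A hA), hXe]
      have e : (A.indicator fun ω => ε (t - (i + 1)) ω * σ (t - (i + 1)) ω) =
          fun ω => ε (t - (i + 1)) ω * A.indicator (σ (t - (i + 1))) ω := by
        funext ω
        by_cases hω : ω ∈ A <;> simp [hω]
      rw [e]
      refine h.integral_mul hε ?_
      obtain ⟨g, hg, hgσ⟩ := hσm (t - (i + 1))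
      exact ⟨A.indicator g, hg.indicator hA', hgσ.indicator⟩
    have hsub : ∫ ω in A, ∑ i ∈ Finset.range n, b i.succPNat * X (t - (i + 1)) ω ∂μ = 0 := by
      rw [integral_finsetSum (f := fun (i : ℕ) ω => b i.succPNat * X (t - (i + 1)) ω) _
        fun i _ => (((hX2 _).integrable one_le_two).const_mul _).integrableOn]
      refine Finset.sum_eq_zero fun i hi => ?_
      rw [integral_const_mul, hzero i (Finset.mem_range.1 hi), mul_zero]
    rw [← sub_eq_zero, ← integral_sub (hR2.integrable one_le_two).integrableOn
      (hf2.integrable one_le_two).integrableOn, ← neg_eq_zero, ← integral_neg, ← hsub]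
    refine integral_congr_ae (ae_of_all _ fun ω => ?_)
    simp only [larchPartialSum]
    ring
  -- The terms after the first `n` have times before `t - n`, so the remainder, as a limit in
  -- measure, is measurable with respect to `ℱ (t - n)`.
  · have htail : ∀ k : ℕ, AEStronglyMeasurable[ℱ (t - n)]
        (fun ω => larchPartialSum a b X t (n + k) ω - larchPartialSum a b X t n ω) μ := by
      intro k
      induction k with
      | zero => simpa using aestronglyMeasurable_const
      | succ k ih =>
        simp_rw [← add_assoc, larchPartialSum_succ]
        have : AEStronglyMeasurable[ℱ (t - n)] (X (t - ((n + k : ℕ) + 1))) μ := by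
          rw [hXe]; exact h.aestronglyMeasurable_mul (by push_cast; omega) (hσm _)
        refine (ih.add (this.const_mul (b (n + k).succPNat))).congr (ae_of_all _ fun ω => ?_)
        simp only [Pi.add_apply]
        ring
    refine aestronglyMeasurable_of_tendstoInMeasure htail ?_
    refine TendstoInMeasure.fun_sub (f' := fun _ => larchPartialSum a b X t n) ?_ ?_
    · exact hlim.comp (tendsto_add_atTop_nat n |>.congr fun k => add_comm k n)
    · exact tendstoInMeasure_of_tendsto_ae (fun _ => (hP n).1)
        (ae_of_all _ fun ω => tendsto_const_nhds)

/-- For a causal solution, `L²` convergence of the series `∑ b_j X_{t-j}` implies its almost sure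
convergence. -/
theorem IsPast.ae_tendsto_larchPartialSum [IsProbabilityMeasure μ] {ε : ℤ → Ω → ℝ}
    {ℱ : ℤ → MeasurableSpace Ω} (h : IsPast μ ε ℱ) (hε : IsInnovation μ ε) (a : ℝ) (b : ℕ+ → ℝ)
    {X σ : ℤ → Ω → ℝ} (hX : ∀ t ω, X t ω = ε t ω * σ t ω)
    (hσm : ∀ t, AEStronglyMeasurable[ℱ t] (σ t) μ) (hσ2 : ∀ t, MemLp (σ t) 2 μ) (t : ℤ)
    (hlim : Tendsto (fun n => eLpNorm (fun ω => larchPartialSum a b X t n ω - σ t ω) 2 μ)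
      atTop (𝓝 0)) :
    ∀ᵐ ω ∂μ, Tendsto (fun n => larchPartialSum a b X t n ω) atTop (𝓝 (σ t ω)) := by
  have hX2 : ∀ t, MemLp (X t) 2 μ := fun t => by
    rw [funext (hX t)]; exact h.memLp_mul hε (hσm t) (hσ2 t)
  have hP := memLp_larchPartialSum a b hX2 t
  have hae := h.sub_larchPartialSum_ae_eq_condExp hε a b hX hσm hσ2 t
    (tendstoInMeasure_of_tendsto_eLpNorm two_ne_zero (fun n => (hP n).1) (hσ2 t).1 hlim)
  have hanti : Antitone fun n : ℕ => ℱ (t - n) := fun i j hij => h.mono (by omega)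
  have key := tendsto_ae_condExp_antitone_of_tendsto_integral_abs (μ := μ) hanti
    (fun n => h.le _) (fun ω => σ t ω - a) ?_
  · filter_upwards [key, ae_all_iff.2 hae] with ω h1 h2
    simp_rw [← h2] at h1
    simpa using (tendsto_const_nhds (x := σ t ω)).sub h1
  · have hle : ∀ n : ℕ, ∫ ω, |(μ[fun ω => σ t ω - a|ℱ (t - n)]) ω| ∂μ ≤
        (eLpNorm (fun ω => larchPartialSum a b X t n ω - σ t ω) 2 μ).toReal := by
      intro n
      have hD : MemLp (fun ω => larchPartialSum a b X t n ω - σ t ω) 2 μ := (hP n).sub (hσ2 t)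
      have e : ∫ ω, |(μ[fun ω => σ t ω - a|ℱ (t - n)]) ω| ∂μ =
          ∫ ω, ‖larchPartialSum a b X t n ω - σ t ω‖ ∂μ := by
        refine integral_congr_ae ?_
        filter_upwards [hae n] with ω hω
        rw [← hω, Real.norm_eq_abs, abs_sub_comm]
      rw [e, integral_norm_eq_lintegral_enorm hD.1, ← eLpNorm_one_eq_lintegral_enorm]
      exact ENNReal.toReal_mono hD.2.ne (eLpNorm_le_eLpNorm_of_exponent_le one_le_two hD.1)
    refine squeeze_zero (fun n => integral_nonneg fun ω => abs_nonneg _) hle ?_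
    simpa [Function.comp_def] using (ENNReal.tendsto_toReal ENNReal.zero_ne_top).comp hlim

end AlmostSure

/-! ### Stationarity and ergodicity of equivariant images. -/

section Stationary

variable {Ω : Type*} [MeasurableSpace Ω] {μ : Measure Ω} {X σ : ℤ → Ω → ℝ}

theorem measurable_pairPath (hX : ∀ t, Measurable (X t)) (hσ : ∀ t, Measurable (σ t)) :
    Measurable (pairPath X σ) :=
  measurable_pi_iff.2 fun t => (hX t).prodMk (hσ t)

theorem IsStrictlyStationary.identDistrib (h : IsStrictlyStationary μ X σ)
    (hX : ∀ t, Measurable (X t)) (hσ : ∀ t, Measurable (σ t)) (k : ℤ) :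
    IdentDistrib (fun ω => timeShift k (pairPath X σ ω)) (pairPath X σ) μ μ :=
  ⟨((measurable_timeShift k).comp (measurable_pairPath hX hσ)).aemeasurable,
    (measurable_pairPath hX hσ).aemeasurable, h k⟩

theorem IsStrictlyStationary.integral_comp_eq (h : IsStrictlyStationary μ X σ)
    (hX : ∀ t, Measurable (X t)) (hσ : ∀ t, Measurable (σ t)) {φ : ℝ × ℝ → ℝ} (hφ : Measurable φ)
    (s t : ℤ) : ∫ ω, φ (X s ω, σ s ω) ∂μ = ∫ ω, φ (X t ω, σ t ω) ∂μ := by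
  have := ((h.identDistrib hX hσ (s - t)).comp (hφ.comp (measurable_pi_apply t))).integral_eq
  simpa [Function.comp_def, timeShift, pairPath] using this

theorem IsStrictlyStationary.covariance_comp_eq (h : IsStrictlyStationary μ X σ)
    (hX : ∀ t, Measurable (X t)) (hσ : ∀ t, Measurable (σ t)) {φ ψ : ℝ × ℝ → ℝ}
    (hφ : Measurable φ) (hψ : Measurable ψ) (s t k : ℤ) :
    covariance (fun ω => φ (X (s + k) ω, σ (s + k) ω))
        (fun ω => ψ (X (t + k) ω, σ (t + k) ω)) μ =
      covariance (fun ω => φ (X s ω, σ s ω)) (fun ω => ψ (X t ω, σ t ω)) μ := by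
  have hi := h.identDistrib hX hσ k
  have hm : ∀ {θ : ℝ × ℝ → ℝ}, Measurable θ → ∀ (u : ℤ) (ν : Measure (ℤ → ℝ × ℝ)),
      AEStronglyMeasurable (fun x : ℤ → ℝ × ℝ => θ (x u)) ν :=
    fun hθ u ν => (hθ.comp (measurable_pi_apply u)).aestronglyMeasurable
  have h1 := covariance_map_fun (hm hφ s _) (hm hψ t _) hi.aemeasurable_fst
  have h2 := covariance_map_fun (hm hφ s _) (hm hψ t _) hi.aemeasurable_snd
  rw [hi.map_eq, h2] at h1
  exact h1.symm

theorem IsStrictlyStationary.isSecondOrderStationary (h : IsStrictlyStationary μ X σ)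
    (hX : ∀ t, Measurable (X t)) (hσ : ∀ t, Measurable (σ t)) (hX2 : ∀ t, MemLp (X t) 2 μ)
    (hσ2 : ∀ t, MemLp (σ t) 2 μ) : IsSecondOrderStationary μ X σ where
  memLp_X := hX2
  memLp_σ := hσ2
  mean_X := h.integral_comp_eq hX hσ measurable_fst
  mean_σ := h.integral_comp_eq hX hσ measurable_snd
  cov_X := h.covariance_comp_eq hX hσ measurable_fst measurable_fst
  cov_σ := h.covariance_comp_eq hX hσ measurable_snd measurable_snd
  cov_X_σ := h.covariance_comp_eq hX hσ measurable_fst measurable_snd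

/-- A measurable shift-equivariant image of an i.i.d. sequence is strictly stationary and
ergodic. -/
theorem stationary_ergodic_of_equivariant [IsProbabilityMeasure μ] {ε : ℤ → Ω → ℝ}
    (hε : IsInnovation μ ε) {Φ : (ℤ → ℝ) → ℤ → ℝ × ℝ} (hΦ : Measurable Φ)
    (hΦs : ∀ k x, Φ (timeShift k x) = timeShift k (Φ x))
    (hXσ : ∀ ω, pairPath X σ ω = Φ fun t => ε t ω) :
    IsStrictlyStationary μ X σ ∧ IsErgodicProcess μ X σ := by
  have hpath : Measurable fun ω t => ε t ω := measurable_pi_iff.2 hε.measurable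
  have e : pairPath X σ = Φ ∘ fun ω t => ε t ω := funext hXσ
  have hmp : MeasurePreserving Φ (μ.map fun ω t => ε t ω) (μ.map (pairPath X σ)) :=
    ⟨hΦ, by rw [e, Measure.map_map hΦ hpath]⟩
  constructor
  · intro k
    have e' : (fun ω => timeShift k (pairPath X σ ω)) =
        Φ ∘ timeShift k ∘ fun ω t => ε t ω := by
      funext ω
      simp only [hXσ, Function.comp_apply, hΦs]
    rw [e', ← Measure.map_map hΦ ((measurable_timeShift k).comp hpath),
      ← Measure.map_map (measurable_timeShift k) hpath,
      (iid_measurePreserving_timeShift hε.measurable hε.indep hε.identDistrib k).map_eq,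
      hmp.map_eq]
  · exact hmp.ergodic_of_ergodic_semiconj
      (iid_ergodic_timeShift hε.measurable hε.indep hε.identDistrib) (measurable_timeShift 1)
      fun x => hΦs 1 x

end Stationary

/-! ### From lists of lags to tuples with partial sums. -/

section VolterraTerm

variable {Ω : Type*} {ε : ℤ → Ω → ℝ}

theorem Fin.sum_Iic_succ {M : Type*} [AddCommMonoid M] {k : ℕ} (f : Fin (k + 1) → M) (i : Fin k) :
    ∑ l ∈ Finset.Iic i.succ, f l = f 0 + ∑ l ∈ Finset.Iic i, f l.succ := by
  have e : ∀ {n : ℕ} (j : Fin n), Finset.Iic j = Finset.univ.filter (· ≤ j) := fun j => by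
    ext; simp
  rw [e, e, Finset.sum_filter, Finset.sum_filter, Fin.sum_univ_succ]
  simp

theorem volterraMonomial_ofFn_pastPath (b : ℕ+ → ℝ) {k : ℕ} (v : Fin k → ℕ+) (t : ℤ) (ω : Ω) :
    volterraMonomial b (List.ofFn v) (pastPath ε t ω) =
      (∏ i, b (v i)) * ∏ i, ε (t - ∑ l ∈ Finset.Iic i, ((v l : ℕ) : ℤ)) ω := by
  induction k generalizing t with
  | zero => simp [volterraMonomial]
  | succ k ih =>
    rw [List.ofFn_succ, volterraMonomial_cons_pastPath, ih, Fin.prod_univ_succ,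
      Fin.prod_univ_succ]
    have h0 : ∑ l ∈ Finset.Iic (0 : Fin (k + 1)), ((v l : ℕ) : ℤ) = (v 0 : ℕ) := by
      have : Finset.Iic (0 : Fin (k + 1)) = {0} := by ext; simp
      rw [this, Finset.sum_singleton]
    simp_rw [Fin.sum_Iic_succ, h0, sub_add_eq_sub_sub]
    ring

theorem volterraMonomial_eq_volterraTerm (b : ℕ+ → ℝ) (p : VolterraIndex) (t : ℤ) (ω : Ω) :
    volterraMonomial b (List.ofFn p.2) (pastPath ε t ω) = volterraTerm b ε t p ω :=
  volterraMonomial_ofFn_pastPath b p.2 t ω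

theorem volterraIndex_ofFn_injective :
    Function.Injective fun p : VolterraIndex => List.ofFn p.2 := by
  rintro ⟨k, v⟩ ⟨k', v'⟩ h
  have hk : k = k' := by
    have := congrArg List.length h
    simpa using this
  subst hk
  exact congrArg (Sigma.mk k) (List.ofFn_injective h)

theorem range_volterraIndex_ofFn :
    Set.range (fun p : VolterraIndex => List.ofFn p.2) = {[]}ᶜ := by
  ext l
  simp only [Set.mem_range, Set.mem_compl_iff, Set.mem_singleton_iff]
  constructor
  · rintro ⟨⟨k, v⟩, rfl⟩
    simp [List.ofFn_eq_nil_iff]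
  · intro hl
    exact ⟨⟨⟨l.length, List.length_pos_iff.2 hl⟩, l.get⟩, List.ofFn_get l⟩

end VolterraTerm

/-! ### The LARCH recursion, causality and uniqueness. -/

section Solution

theorem measurable_pair_of_lt {Ω : Type*} (ε X : ℤ → Ω → ℝ) {s t : ℤ} (hst : s < t) :
    Measurable[MeasurableSpace.comap (fun ω (s : Set.Iio t) => (ε s ω, X s ω)) inferInstance]
      fun ω => (ε s ω, X s ω) :=
  (measurable_pi_apply (⟨s, hst⟩ : Set.Iio t)).comp
    (comap_measurable fun ω (s : Set.Iio t) => (ε s ω, X s ω))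

variable {Ω : Type*} [MeasurableSpace Ω] {μ : Measure Ω} {ε : ℤ → Ω → ℝ}

theorem memLp_mul_comp_pastPath (hε : IsInnovation μ ε) {G : (ℕ → ℝ) → ℝ} (hGm : Measurable G)
    (c : ℝ) {t : ℤ} (hG : MemLp (fun ω => G (pastPath ε t ω)) 2 μ) :
    MemLp (fun ω => ε t ω * (c * G (pastPath ε t ω))) 2 μ :=
  hε.isPast_pastPath.memLp_mul hε ((aestronglyMeasurable_comp_pastPath hGm t).const_mul c)
    (hG.const_mul c)

/-- Sorting the Volterra series by its first index gives the LARCH recursion. -/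
theorem hasSum_larch_of_hasSum_volterra [IsProbabilityMeasure μ] (hε : IsInnovation μ ε)
    {b : ℕ+ → ℝ} {G : (ℕ → ℝ) → ℝ} (hGm : Measurable G)
    (hG2 : ∀ t, MemLp (fun ω => G (pastPath ε t ω)) 2 μ)
    (hG : ∀ t, HasSum (fun l => (memLp_volterraMonomial hε b l t).toLp _) ((hG2 t).toLp _))
    (t : ℤ) :
    HasSum (fun j : ℕ+ => (memLp_mul_comp_pastPath hε hGm (b j) (hG2 (t - j))).toLp _)
      (((hG2 t).sub (memLp_const 1)).toLp _) := by
  let i : ℕ+ × List ℕ+ → List ℕ+ := fun p => p.1 :: p.2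
  have hi : Function.Injective i := fun p q h => by
    simp only [i, List.cons.injEq] at h
    exact Prod.ext h.1 h.2
  have hr : Set.range i = {[]}ᶜ := by
    ext l
    cases l <;> simp [i]
  have h := (hG t).comp_injective_of_range_eq_compl_singleton [] hi hr
  rw [← MemLp.toLp_sub] at h
  -- Lists with head `j` sum to b_j ε_{t-j} times the full series at time `t - j`, because
  -- multiplication by ε_{t-j} preserves L² norms of functionals of its past.
  refine h.prod_fiberwise fun j => ?_
  have hj := (hasSum_toLp_iff (fun l => memLp_volterraMonomial hε b l (t - j))
    (hG2 (t - j))).1 (hG (t - j))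
  refine (hasSum_toLp_iff (fun l => memLp_volterraMonomial hε b (j :: l) t) _).2 ?_
  have e : ∀ F : Finset (List ℕ+), eLpNorm (fun ω => ∑ l ∈ F, volterraMonomial b (j :: l)
      (pastPath ε t ω) - ε (t - j) ω * (b j * G (pastPath ε (t - j) ω))) 2 μ =
      ‖b j‖ₑ * eLpNorm (fun ω => ∑ l ∈ F, volterraMonomial b l (pastPath ε (t - j) ω) -
        G (pastPath ε (t - j) ω)) 2 μ := by
    intro F
    have hm : Measurable fun y => b j * (∑ l ∈ F, volterraMonomial b l y - G y) :=
      ((Finset.measurable_fun_sum F fun l _ => measurable_volterraMonomial b l).sub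
        hGm).const_mul _
    have h1 := hε.isPast_pastPath.eLpNorm_mul hε
      (aestronglyMeasurable_comp_pastPath (ε := ε) (μ := μ) hm (t - j))
    rw [← eLpNorm_const_smul]
    refine Eq.trans ?_ h1
    congr 1
    funext ω
    simp_rw [volterraMonomial_cons_pastPath]
    rw [← Finset.mul_sum, ← Finset.mul_sum]
    ring
  simp_rw [e]
  simpa using ENNReal.Tendsto.const_mul hj (Or.inr enorm_ne_top)

/-- The sum of the Volterra series solves the LARCH equation in `L²`. -/
theorem tendsto_eLpNorm_larchPartialSum [IsProbabilityMeasure μ] (hε : IsInnovation μ ε)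
    (a : ℝ) {b : ℕ+ → ℝ} {G : (ℕ → ℝ) → ℝ} (hGm : Measurable G)
    (hG2 : ∀ t, MemLp (fun ω => G (pastPath ε t ω)) 2 μ)
    (hG : ∀ t, HasSum (fun l => (memLp_volterraMonomial hε b l t).toLp _) ((hG2 t).toLp _))
    (t : ℤ) :
    Tendsto (fun n => eLpNorm (fun ω => larchPartialSum a b
      (fun t ω => ε t ω * (a * G (pastPath ε t ω))) t n ω - a * G (pastPath ε t ω)) 2 μ)
      atTop (𝓝 0) := by
  have h := hasSum_larch_of_hasSum_volterra hε hGm hG2 hG t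
  rw [← Equiv.pnatEquivNat.symm.hasSum_iff] at h
  have h' := ((hasSum_toLp_iff (fun i : ℕ => memLp_mul_comp_pastPath hε hGm (b i.succPNat)
    (hG2 (t - i.succPNat))) _).1 h).comp tendsto_finset_range
  have h'' := ENNReal.Tendsto.const_mul h' (Or.inr (enorm_ne_top (x := a)))
  rw [mul_zero] at h''
  refine h''.congr fun n => ?_
  simp only [Function.comp_apply]
  rw [← eLpNorm_const_smul]
  congr 1
  funext ω
  simp only [Pi.smul_apply, Pi.sub_apply, smul_eq_mul, larchPartialSum, mul_sub, Finset.mul_sum,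
    Nat.succPNat_coe, Nat.succ_eq_add_one, Nat.cast_add, Nat.cast_one]
  have e : ∀ i : ℕ, a * (ε (t - (i + 1)) ω * (b i.succPNat * G (pastPath ε (t - (i + 1)) ω))) =
      b i.succPNat * (ε (t - (i + 1)) ω * (a * G (pastPath ε (t - (i + 1)) ω))) :=
    fun i => by ring
  simp_rw [e]
  ring

theorem isVolterraSeries_of_hasSum [IsProbabilityMeasure μ] (hε : IsInnovation μ ε)
    (a : ℝ) {b : ℕ+ → ℝ} {G : (ℕ → ℝ) → ℝ} (hG2 : ∀ t, MemLp (fun ω => G (pastPath ε t ω)) 2 μ)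
    (hG : ∀ t, HasSum (fun l => (memLp_volterraMonomial hε b l t).toLp _) ((hG2 t).toLp _)) :
    IsVolterraSeries μ a b ε fun t ω => a * G (pastPath ε t ω) := by
  intro t
  have h := (hG t).comp_injective_of_range_eq_compl_singleton []
    volterraIndex_ofFn_injective range_volterraIndex_ofFn
  rw [← MemLp.toLp_sub] at h
  have h' := (hasSum_toLp_iff (fun p : VolterraIndex =>
    memLp_volterraMonomial hε b (List.ofFn p.2) t) _).1 h
  have h'' := ENNReal.Tendsto.const_mul h' (Or.inr (enorm_ne_top (x := -a)))
  rw [mul_zero] at h''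
  refine h''.congr fun F => ?_
  rw [← eLpNorm_const_smul]
  congr 1
  funext ω
  simp only [Pi.smul_apply, Pi.sub_apply, smul_eq_mul, volterraMonomial_eq_volterraTerm,
    volterraMonomial]
  ring

theorem isNonanticipative_of_pastPath (hε : IsInnovation μ ε) {g : (ℕ → ℝ) → ℝ}
    (hg : Measurable g) : IsNonanticipative μ ε fun t ω => ε t ω * g (pastPath ε t ω) := by
  intro t
  have hp := hε.isPast_pastPath
  rw [IndepFun_iff_Indep]
  refine indep_of_indep_of_le_right (hp.indep t) (Measurable.comap_le ?_)
  refine (@measurable_pi_iff _ _ _ (_) _ _).2 fun s => ?_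
  have hs : (s : ℤ) < t := s.2
  exact (hp.measurable s t hs).prodMk ((hp.measurable s t hs).mul
    ((measurable_comp_pastPath hg s).mono (hp.mono hs.le) le_rfl))

/-- The past generated by the innovations and by a nonanticipative process. -/
theorem IsNonanticipative.isPast (hε : IsInnovation μ ε) {X : ℤ → Ω → ℝ}
    (hX : ∀ t, Measurable (X t)) (h : IsNonanticipative μ ε X) :
    IsPast μ ε fun t => MeasurableSpace.comap
      (fun ω (s : Set.Iio t) => (ε s ω, X s ω)) inferInstance where
  le t := (measurable_pi_iff.2 fun s : Set.Iio t =>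
    (hε.measurable s).prodMk (hX s)).comap_le
  mono s t hst := by
    refine Measurable.comap_le ((@measurable_pi_iff _ _ _ (_) _ _).2 fun u => ?_)
    exact measurable_pair_of_lt ε X (lt_of_lt_of_le u.2 hst)
  measurable s t hst := measurable_fst.comp (measurable_pair_of_lt ε X hst)
  indep t := by
    have := h t
    rwa [IndepFun_iff_Indep] at this

theorem IsPast.measurable_pastPath {ℱ : ℤ → MeasurableSpace Ω} (h : IsPast μ ε ℱ) (t : ℤ) :
    Measurable[ℱ t] (pastPath ε t) :=
  (@measurable_pi_iff _ _ _ (_) _ _).2 fun n => h.measurable _ t (by omega)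

/-- Nonanticipative stationary solutions of the LARCH equations are unique. -/
theorem ae_eq_of_isLARCHSolution [IsProbabilityMeasure μ] (hε : IsInnovation μ ε) {a : ℝ}
    {b : ℕ+ → ℝ} (hb : Summable fun j => b j ^ 2) (hb1 : ∑' j, b j ^ 2 < 1) {g : (ℕ → ℝ) → ℝ}
    (hg : Measurable g) {X σ X' σ' : ℤ → Ω → ℝ} (hX : ∀ t ω, X t ω = ε t ω * σ t ω)
    (hσ : ∀ t ω, σ t ω = g (pastPath ε t ω)) (h : IsLARCHSolution μ a b ε X σ)
    (hs : IsStrictlyStationary μ X σ) (hX2 : ∀ t, MemLp (X t) 2 μ)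
    (h' : IsLARCHSolution μ a b ε X' σ') (hn' : IsNonanticipative μ ε X')
    (hs' : IsStrictlyStationary μ X' σ') (hX2' : ∀ t, MemLp (X' t) 2 μ) (t : ℤ) :
    X' t =ᵐ[μ] X t ∧ σ' t =ᵐ[μ] σ t := by
  -- The past of the competing solution also contains the constructed one, a functional of the
  -- innovations alone, so the difference is adapted to it.
  have hp := hn'.isPast hε h'.measurable_X
  have key := hp.ae_eq_zero_of_homogeneous hε hb hb1 (D := fun t ω => X' t ω - X t ω)
    (δ := fun t ω => σ' t ω - σ t ω) (C := 2 * (∫ ω, X' 0 ω ^ 2 ∂μ + ∫ ω, X 0 ω ^ 2 ∂μ))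
    ?_ ?_ ?_ ?_ ?_ t
  · obtain ⟨h1, h2⟩ := key
    constructor
    · filter_upwards [h1] with ω hω using sub_eq_zero.1 hω
    · filter_upwards [h2] with ω hω using sub_eq_zero.1 hω
  · intro t
    filter_upwards [h'.eq_X t] with ω hω
    rw [hω, hX, mul_sub]
  · intro s t hst
    refine (Measurable.sub ?_ ?_).stronglyMeasurable.aestronglyMeasurable
    · exact measurable_snd.comp (measurable_pair_of_lt ε X' hst)
    · simp_rw [funext (hX s), hσ]
      exact (hp.measurable s t hst).mul
        ((hg.comp (hp.measurable_pastPath s)).mono (hp.mono hst.le) le_rfl)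
  · exact fun t => (hX2' t).sub (hX2 t)
  · intro t
    have hsq : Measurable fun p : ℝ × ℝ => p.1 ^ 2 := by fun_prop
    rw [← hs'.integral_comp_eq h'.measurable_X h'.measurable_σ hsq t 0,
      ← hs.integral_comp_eq h.measurable_X h.measurable_σ hsq t 0,
      ← integral_add (hX2' t).integrable_sq (hX2 t).integrable_sq, ← integral_const_mul]
    refine integral_mono ((hX2' t).sub (hX2 t)).integrable_sq
      (((hX2' t).integrable_sq.add (hX2 t).integrable_sq).const_mul 2) fun ω => ?_
    beta_reduce
    -- This is (x' - x)² ≤ 2(x'² + x²); with stationarity it gives a bound `C` uniform in time.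
    nlinarith [sq_nonneg (X' t ω + X t ω)]
  · intro t
    refine ((h'.eq_σ t).fun_sub (h.eq_σ t)).congr (fun n => ae_of_all _ fun ω => ?_) .rfl
    simp only [larchPartialSum, mul_sub, Finset.sum_sub_distrib]
    ring

end Solution

theorem proposition1 {Ω : Type*} [MeasurableSpace Ω] (μ : Measure Ω) [IsProbabilityMeasure μ]
    (ε : ℤ → Ω → ℝ) (hε : IsInnovation μ ε)
    (a : ℝ) (ha : a ≠ 0)
    (b : ℕ+ → ℝ) (hb : Summable (fun j => b j ^ 2)) (hb1 : ∑' j, b j ^ 2 < 1) :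
    ∃ X σ : ℤ → Ω → ℝ,
      IsLARCHSolution μ a b ε X σ ∧
      (∀ t, Tendsto (fun n => eLpNorm (fun ω => larchPartialSum a b X t n ω - σ t ω) 2 μ)
        atTop (𝓝 0)) ∧
      (∀ t, ∀ᵐ ω ∂μ, Tendsto (fun n => larchPartialSum a b X t n ω) atTop (𝓝 (σ t ω))) ∧
      IsNonanticipative μ ε X ∧
      IsStrictlyStationary μ X σ ∧
      IsSecondOrderStationary μ X σ ∧
      IsVolterraSeries μ a b ε σ ∧
      IsErgodicProcess μ X σ ∧
      ∀ X' σ' : ℤ → Ω → ℝ,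
        IsLARCHSolution μ a b ε X' σ' → IsNonanticipative μ ε X' →
        IsStrictlyStationary μ X' σ' → IsSecondOrderStationary μ X' σ' →
        ∀ t, X' t =ᵐ[μ] X t ∧ σ' t =ᵐ[μ] σ t := by
  obtain ⟨G, hGm, hG'⟩ := exists_volterra_functional hε hb hb1
  choose hG2 hG using hG'
  have hp := hε.isPast_pastPath
  have hgm : Measurable fun y => a * G y := hGm.const_mul a
  let σ : ℤ → Ω → ℝ := fun t ω => a * G (pastPath ε t ω)
  let X : ℤ → Ω → ℝ := fun t ω => ε t ω * σ t ω
  have hσm : ∀ t, Measurable (σ t) := fun t => hgm.comp (hε.measurable_pastPath t)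
  have hXm : ∀ t, Measurable (X t) := fun t => (hε.measurable t).mul (hσm t)
  have hσ2 : ∀ t, MemLp (σ t) 2 μ := fun t => (hG2 t).const_mul a
  have hX2 : ∀ t, MemLp (X t) 2 μ := fun t => memLp_mul_comp_pastPath hε hGm a (hG2 t)
  have hL2 := tendsto_eLpNorm_larchPartialSum hε a hGm hG2 hG
  have hsol : IsLARCHSolution μ a b ε X σ :=
    ⟨hXm, hσm, fun t => ae_of_all _ fun ω => rfl, fun t =>
      tendstoInMeasure_of_tendsto_eLpNorm two_ne_zero
        (fun n => (memLp_larchPartialSum a b hX2 t n).1) (hσ2 t).1 (hL2 t)⟩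
  -- The volatility as an explicit shift-equivariant function of the whole innovation path.
  let Ψ : (ℤ → ℝ) → ℤ → ℝ := fun x t => a * G fun n => x (t - (n + 1))
  have hΨ : ∀ t, Measurable fun x => Ψ x t := fun t =>
    hgm.comp (measurable_pi_iff.2 fun n => measurable_pi_apply _)
  obtain ⟨hstat, herg⟩ := stationary_ergodic_of_equivariant (X := X) (σ := σ) hε
    (Φ := fun x t => (x t * Ψ x t, Ψ x t))
    (measurable_pi_iff.2 fun t => ((measurable_pi_apply t).mul (hΨ t)).prodMk (hΨ t))
    (fun k x => by
      funext t
      simp only [timeShift, Ψ, sub_add_eq_add_sub])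
    (fun ω => rfl)
  refine ⟨X, σ, hsol, hL2, fun t => ?_, isNonanticipative_of_pastPath hε hgm, hstat,
    hstat.isSecondOrderStationary hXm hσm hX2 hσ2, isVolterraSeries_of_hasSum hε a hG2 hG, herg,
    fun X' σ' h' hn' hs' h2' => ?_⟩
  · exact hp.ae_tendsto_larchPartialSum hε a b (fun _ _ => rfl)
      (fun t => aestronglyMeasurable_comp_pastPath hgm t) hσ2 t (hL2 t)
  · exact ae_eq_of_isLARCHSolution hε hb hb1 hgm (fun _ _ => rfl) (fun _ _ => rfl) hsol hstat hX2
      h' hn' hs' h2'.memLp_X
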